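/- Let $d\ge 1$, and equip $\mathbb R^d\times\mathbb R$ with Lebesgue measure. For $r,t\ge 0$ put $S_r^t=\{(x,s)\in\mathbb R^d\times\mathbb R:\ \|x\|\le r,\ |s|\le t\}$. Let $\beta,R_S,R_T>0$, and let $Y$ be a stationary spatio-temporal hard core process: a stationary simple locally finite point process on $\mathbb R^d\times\mathbb R$ with Papangelou conditional intensity $\lambda_Y(a,b;\varphi)=\beta\,\mathbf 1\{\varphi\cap((a,b)+S_{R_S}^{R_T})=\emptyset\}$, that is, $$\mathbb E\sum_{y\in Y}g(y,Y\setminus\{y\})=\int \mathbb E\big[g(y,Y)\,\lambda_Y(y;Y)\big]\,dy\qquad\text{for all measurable } g\ge 0 .$$ Let $\lambda$ be its (constant) intensity, and let $\mathbb P^{!(0,0)}$ be its reduced Palm distribution at the origin, where the reduced Palm distributions at the other points are chosen as the translates of $\mathbb P^{!(0,0)}$. Put $F(r,t)=\mathbb P(Y\cap S_r^t\ne\emptyset)$, $G(r,t)=\mathbb P^{!(0,0)}(Y\cap S_r^t\neq\emptyset)$, $J(r,t)=\dfrac{1-G(r,t)}{1-F(r,t)}$ and $J(r)=J(r,r)$.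 Then: 1. $\beta/\lambda\ge 1$, and $F(r,t)\ne 1$ for all $r,t\ge 0$, so that $J$ is defined on $[0,\infty)^2$. 2. $J(r,t)$ is increasing (in the weak sense) in $r$ and $t$ on $[0,R_S]\times[0,R_T]$ and on $[R_S,\infty)\times[R_T,\infty)$. 3. $1\le J(r,t)\le\beta/\lambda$ on $[0,R_S]\times[0,R_T]$, and $J(r,t)=\beta/\lambda$ on $[R_S,\infty)\times[R_T,\infty)$. 4. If $R_S=R_T=R$, then $J(r)$ is increasing (in the weak sense) on $[0,\infty)$, $1\le J(r)<\beta/\lambda$ for $r\in[0,R)$, and $J(r)=\beta/\lambda$ for $r\ge R$. 5. Let $p:\mathbb R^d\times\mathbb R\to(0,1]$ be measurable with $\inf p>0$, and let $Y_{\rm th}$ be the thinning of $Y$ in which, given $Y$, the points $y\in Y$ are retained independently of each other with probabilities $p(y)$. Let $\rho^{(n)}$, $n\ge1$, be product densities of $Y_{\rm th}$ (permutation invariant, locally integrable densities of the factorial moment measures), put $\lambda_{\rm th}=\rho^{(1)}$ and $\bar\lambda=\inf\lambda_{\rm th}$, and let $\xi_n$ be the $n$-point correlation functions, defined recursively by $$\frac{\rho^{(n)}(z_1,\dots,z_n)}{\prod_{k}\lambda_{\rm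 th}(z_k)}=\sum_{\pi}\prod_{D\in\pi}\xi_{|D|}(z_i:i\in D),$$ where $\pi$ runs over the partitions of $\{1,\dots,n\}$ into non-empty blocks. Suppose that the versions of the densities are such that $\bar\lambda>0$ and every $\xi_n$ is invariant under joint translation of its arguments (intensity-reweighted moment stationarity). Set $$J_{\rm inhom}^{\rm th}(r,t)=1+\sum_{n\ge1}\frac{(-\bar\lambda)^n}{n!}\int_{(S_r^t)^n}\xi_{n+1}((0,0),z_1,\dots,z_n)\,dz_1\cdots dz_n ,$$ which is defined for those $(r,t)$ for which the series converges absolutely. Then $J_{\rm inhom}^{\rm th}(r,t)\ge1$ for all $0\le r\le R_S$ and $0\le t\le R_T$ at which it is defined. -/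

import Mathlib

open MeasureTheory ProbabilityTheory
open scoped ENNReal

noncomputable section

namespace STPP

/-- Space-time `ℝ^d × ℝ`. The product norm is `max ‖x‖ |t|` with the Euclidean norm on `ℝ^d`. -/
abbrev SpaceTime (d : ℕ) : Type := EuclideanSpace ℝ (Fin d) × ℝ

/-- The cylinder `S_r^t = {(x, s) : ‖x‖ ≤ r, |s| ≤ t}`. -/
def cyl (d : ℕ) (r t : ℝ) : Set (SpaceTime d) := {y | ‖y.1‖ ≤ r ∧ |y.2| ≤ t}

/-- Locally finite simple configurations, i.e. simple locally finite counting measures, identified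
with their supports. -/
structure Config (d : ℕ) where
  pts : Set (SpaceTime d)
  locFinite : ∀ B : Set (SpaceTime d), Bornology.IsBounded B → (pts ∩ B).Finite

namespace Config

variable {d : ℕ}

/-- The number of points `|φ ∩ A|`. -/
def count (A : Set (SpaceTime d)) (φ : Config d) : ℕ∞ := (φ.pts ∩ A).encard

/-- The smallest σ-algebra making all counts `φ ↦ |φ ∩ A|`, `A` Borel, measurable. -/
instance instMeasurableSpace : MeasurableSpace (Config d) :=
  ⨆ (A : Set (SpaceTime d)) (_ : MeasurableSet A), MeasurableSpace.comap (count A) ⊤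

/-- `φ \ {x}`. -/
def erase (φ : Config d) (x : SpaceTime d) : Config d where
  pts := φ.pts \ {x}
  locFinite B hB := (φ.locFinite B hB).subset fun _ hy => ⟨hy.1.1, hy.2⟩

/-- The translated configuration `φ + a`. -/
def translate (a : SpaceTime d) (φ : Config d) : Config d where
  pts := {y | y - a ∈ φ.pts}
  locFinite B hB := by
    have h1 : Bornology.IsBounded ((fun y => y - a) '' B) := by
      have h := hB.sub (Bornology.isBounded_singleton (x := a))
      rwa [Set.sub_singleton] at h
    refine Set.Finite.of_finite_image (f := fun y => y - a)
      ((φ.locFinite _ h1).subset ?_) (sub_left_injective.injOn)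
    rintro _ ⟨y, hy, rfl⟩
    exact ⟨hy.1, Set.mem_image_of_mem _ hy.2⟩

/-- The points of `φ` that are retained, `b x` telling whether `x` is retained. -/
def retain (φ : Config d) (b : φ.pts → Bool) : Config d where
  pts := {y | ∃ h : y ∈ φ.pts, b ⟨y, h⟩ = true}
  locFinite B hB := (φ.locFinite B hB).subset fun _ hy => ⟨hy.1.1, hy.2⟩

theorem measurable_count {A : Set (SpaceTime d)} (hA : MeasurableSet A) :
    @Measurable _ _ instMeasurableSpace ⊤ (count A) := by
  refine Measurable.of_comap_le ?_
  exact le_iSup₂_of_le (f := fun (A : Set (SpaceTime d)) (_ : MeasurableSet A) =>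
    MeasurableSpace.comap (count A) ⊤) A hA le_rfl

theorem measurable_translate (a : SpaceTime d) : Measurable (translate (d := d) a) := by
  refine Measurable.of_le_map ?_
  refine iSup₂_le fun A hA => ?_
  rw [← MeasurableSpace.comap_le_iff_le_map, MeasurableSpace.comap_comp]
  have h : count A ∘ translate a = count ((fun y => y + a) ⁻¹' A) := by
    funext φ
    have : (translate a φ).pts ∩ A = (fun y => y + a) '' (φ.pts ∩ (fun y => y + a) ⁻¹' A) := by
      ext y
      constructor
      · rintro ⟨h1, h2⟩
        exact ⟨y - a, ⟨h1, by simpa using h2⟩, by simp⟩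
      · rintro ⟨x, ⟨h1, h2⟩, rfl⟩
        exact ⟨by simpa [translate] using h1, h2⟩
    simp only [Function.comp_apply, count, this]
    exact (add_left_injective a).injOn.encard_image
  rw [h]
  exact (measurable_count (hA.preimage (measurable_add_const a))).comap_le

end Config

variable {d : ℕ}

/-- `∑_{x ∈ φ} g (x, φ \ {x})`. -/
def reducedSum (g : SpaceTime d × Config d → ℝ≥0∞) (φ : Config d) : ℝ≥0∞ :=
  ∑' x : φ.pts, g (x, φ.erase x)

/-- The sum of `h (z_1, …, z_n)` over all `n`-tuples of pairwise distinct points of `φ`. -/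
def distinctSum {n : ℕ} (h : (Fin n → SpaceTime d) → ℝ≥0∞) (φ : Config d) : ℝ≥0∞ :=
  ∑' z : {z : Fin n → SpaceTime d // Function.Injective z ∧ ∀ i, z i ∈ φ.pts}, h z

/-- The law `P` of a point process is invariant under translations. -/
def IsStationary (P : Measure (Config d)) : Prop :=
  ∀ a : SpaceTime d, P.map (Config.translate a) = P

/-- `ρ` is (a version of) the `n`-th product density of a point process with law `P`: it is the
permutation invariant density of the locally finite `n`-th factorial moment measure. -/
structure IsProductDensity (P : Measure (Config d)) (n : ℕ)
    (ρ : (Fin n → SpaceTime d) → ℝ) : Prop where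
  measurable : Measurable ρ
  nonneg : ∀ z, 0 ≤ ρ z
  symm : ∀ (σ : Equiv.Perm (Fin n)) (z : Fin n → SpaceTime d), ρ (z ∘ σ) = ρ z
  locallyIntegrable : LocallyIntegrable ρ
  campbell : ∀ h : (Fin n → SpaceTime d) → ℝ≥0∞, Measurable h →
    ∫⁻ φ, distinctSum h φ ∂P = ∫⁻ z, h z * ENNReal.ofReal (ρ z)

/-- `K x` is the reduced Palm distribution at `x` of a point process with law `P` and intensity
function `lam` (reduced Campbell-Mecke formula). -/
def IsReducedPalm (P : Measure (Config d)) (lam : SpaceTime d → ℝ)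
    (K : Kernel (SpaceTime d) (Config d)) : Prop :=
  ∀ g : SpaceTime d × Config d → ℝ≥0∞, Measurable g →
    ∫⁻ φ, reducedSum g φ ∂P =
      ∫⁻ x, (∫⁻ φ, g (x, φ) ∂(K x)) * ENNReal.ofReal (lam x)

/-- `c (x, φ)` is a Papangelou conditional intensity of a point process with law `P`
(Georgii-Nguyen-Zessin formula). -/
structure IsPapangelou (P : Measure (Config d)) (c : SpaceTime d × Config d → ℝ) : Prop where
  measurable : Measurable c
  nonneg : ∀ y, 0 ≤ c y
  gnz : ∀ g : SpaceTime d × Config d → ℝ≥0∞, Measurable g →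
    ∫⁻ φ, reducedSum g φ ∂P =
      ∫⁻ x, ∫⁻ φ, g (x, φ) * ENNReal.ofReal (c (x, φ)) ∂P

open Classical in
/-- `β 1{φ ∩ (x + S_{RS}^{RT}) = ∅}`. -/
def hardCoreIntensity (β RS RT : ℝ) (y : SpaceTime d × Config d) : ℝ :=
  if y.2.pts ∩ {z | z - y.1 ∈ cyl d RS RT} = ∅ then β else 0

/-- `P` is the law of a stationary hard core process with parameter `β` and hard core distances
`RS` (space) and `RT` (time). -/
structure IsHardCore (β RS RT : ℝ) (P : Measure (Config d)) : Prop where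
  stationary : IsStationary P
  papangelou : IsPapangelou P (hardCoreIntensity β RS RT)

/-- The probability under `P` of a point in `S_r^t`. For `P` the law of the process this is the
empty space function `F (r, t)`; for `P` the reduced Palm distribution at the origin it is the
nearest neighbour distance distribution function `G (r, t)`. -/
def hitProb (P : Measure (Config d)) (r t : ℝ) : ℝ :=
  P.real {φ | (φ.pts ∩ cyl d r t).Nonempty}

/-- The `J`-function `(1 - G (r, t)) / (1 - F (r, t))` of a stationary process with law `P` and
reduced Palm distribution `Q` at the origin. -/
def J (P Q : Measure (Config d)) (r t : ℝ) : ℝ := (1 - hitProb Q r t) / (1 - hitProb P r t)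

theorem card_lt_of_mem_parts {n : ℕ} {π : Finpartition (Finset.univ : Finset (Fin n))}
    (hπ : π.parts ≠ {Finset.univ}) {D : Finset (Fin n)} (hD : D ∈ π.parts) : D.card < n := by
  refine lt_of_le_of_ne (by simpa using D.card_le_univ) fun h => hπ ?_
  have hu : D = Finset.univ := by
    rw [← Finset.card_eq_iff_eq_univ]; simpa using h
  subst hu
  refine Finset.eq_singleton_iff_unique_mem.2 ⟨hD, fun E hE => ?_⟩
  by_contra hne
  have hdis := π.disjoint hE hD hne
  exact π.ne_bot hE (disjoint_self.1 (hdis.mono_right (Finset.subset_univ E)))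

/-- The `n`-point correlation functions `ξ_n` of the product densities `ρ`: the recursive solution
of `ρ_n (z) / ∏ ρ_1 (z_k) = ∑_π ∏_{D ∈ π} ξ_{|D|} (z_i : i ∈ D)`, `π` running over the partitions
of the index set; the term of the one-block partition is `ξ_n (z)`. -/
def corr (ρ : ∀ n : ℕ, (Fin n → SpaceTime d) → ℝ) (n : ℕ) (z : Fin n → SpaceTime d) : ℝ :=
  ρ n z / ∏ k, ρ 1 (fun _ => z k) -
    ∑ π : {π : Finpartition (Finset.univ : Finset (Fin n)) // π.parts ≠ {Finset.univ}},
      ∏ D : {D // D ∈ π.1.parts}, corr ρ D.1.card (fun i => z (D.1.orderEmbOfFin rfl i))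
  termination_by n
  decreasing_by exact card_lt_of_mem_parts π.2 D.2

/-- The defining relation of the `n`-point correlation functions. -/
theorem corr_relation (ρ : ∀ n : ℕ, (Fin n → SpaceTime d) → ℝ) {n : ℕ} (hn : 1 ≤ n)
    (z : Fin n → SpaceTime d) :
    ρ n z / ∏ k, ρ 1 (fun _ => z k) =
      ∑ π : Finpartition (Finset.univ : Finset (Fin n)),
        ∏ D ∈ π.parts, corr ρ D.card (fun i => z (D.orderEmbOfFin rfl i)) := by
  classical
  have hne : (Finset.univ : Finset (Fin n)) ≠ ∅ :=
    Finset.nonempty_iff_ne_empty.1 ⟨⟨0, hn⟩, Finset.mem_univ _⟩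
  set f : Finpartition (Finset.univ : Finset (Fin n)) → ℝ := fun π =>
    ∏ D ∈ π.parts, corr ρ D.card (fun i => z (D.orderEmbOfFin rfl i)) with hf
  have key : ∀ (m : ℕ) (e : Fin m → Fin n), m = n → StrictMono e →
      corr ρ m (fun i => z (e i)) = corr ρ n z := by
    rintro m e rfl he
    have : e = id := by
      have := Subsingleton.elim (OrderIso.refl (Fin m))
        (he.orderIsoOfSurjective e (Finite.surjective_of_injective he.injective))
      funext i
      exact (congrArg (fun o : Fin m ≃o Fin m => o i) this).symm
    subst this
    rfl
  have h1 : f (Finpartition.indiscrete hne) = corr ρ n z := by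
    simp only [hf, Finpartition.indiscrete_parts, Finset.prod_singleton]
    exact key _ _ (by simp) (Finset.orderEmbOfFin _ rfl).strictMono
  have h2 : ∑ π : {π : Finpartition (Finset.univ : Finset (Fin n)) // π.parts ≠ {Finset.univ}},
      ∏ D : {D // D ∈ π.1.parts}, corr ρ D.1.card (fun i => z (D.1.orderEmbOfFin rfl i)) =
      ∑ π ∈ Finset.univ.erase (Finpartition.indiscrete hne), f π := by
    have hmem : ∀ π : Finpartition (Finset.univ : Finset (Fin n)),
        π ∈ Finset.univ.erase (Finpartition.indiscrete hne) ↔ π.parts ≠ {Finset.univ} := by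
      intro π
      simp [Finpartition.ext_iff]
    rw [Finset.sum_subtype _ hmem f]
    refine Finset.sum_congr rfl fun π _ => ?_
    exact Finset.prod_coe_sort π.1.parts
      (fun D => corr ρ D.card (fun i => z (D.orderEmbOfFin rfl i)))
  have h3 := Finset.add_sum_erase Finset.univ f (Finset.mem_univ (Finpartition.indiscrete hne))
  change _ = ∑ π, f π
  rw [← h3, h1, ← h2]
  conv_rhs => rw [corr]
  ring

/-- The infimum `λ̄` of the intensity function. -/
def infIntensity (ρ : ∀ n : ℕ, (Fin n → SpaceTime d) → ℝ) : ℝ := ⨅ x, ρ 1 (fun _ => x)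

/-- A point process with law `P` is intensity-reweighted moment stationary with product densities
`ρ`. Product densities are only determined up to null sets; the versions are those for which the
correlation functions are translation invariant at all points, so that the integrals of
`ξ_{n+1} (0, z_1, …, z_n)` over `z` do not depend on the version. -/
structure IsIRMS (P : Measure (Config d)) (ρ : ∀ n : ℕ, (Fin n → SpaceTime d) → ℝ) : Prop where
  density : ∀ n, 1 ≤ n → IsProductDensity P n (ρ n)
  inf_pos : 0 < infIntensity ρ
  invariant : ∀ n, 1 ≤ n → ∀ (a : SpaceTime d) (z : Fin n → SpaceTime d),
    corr ρ n (fun i => z i + a) = corr ρ n z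

/-- `J_n (r, t)`, the integral of `ξ_{n+1} ((0,0), z_1, …, z_n)` over `(S_r^t)^n`. -/
def JCoeff (ρ : ∀ n : ℕ, (Fin n → SpaceTime d) → ℝ) (n : ℕ) (r t : ℝ) : ℝ :=
  ∫ z in {z : Fin n → SpaceTime d | ∀ i, z i ∈ cyl d r t},
    corr ρ (n + 1) (Fin.cons (0 : SpaceTime d) z : Fin (n + 1) → SpaceTime d)

/-- The term `(-λ̄)^n / n! * J_n (r, t)`. -/
def JTerm (ρ : ∀ n : ℕ, (Fin n → SpaceTime d) → ℝ) (r t : ℝ) (n : ℕ) : ℝ :=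
  (-infIntensity ρ) ^ n / (n.factorial : ℝ) * JCoeff ρ n r t

/-- The inhomogeneous `J`-function is defined at `(r, t)`: its series converges absolutely. -/
def JInhomDefined (ρ : ∀ n : ℕ, (Fin n → SpaceTime d) → ℝ) (r t : ℝ) : Prop :=
  Summable fun n : ℕ => |JTerm ρ r t (n + 1)|

/-- The inhomogeneous `J`-function `1 + ∑_{n ≥ 1} (-λ̄)^n / n! * J_n (r, t)`. -/
def JInhom (ρ : ∀ n : ℕ, (Fin n → SpaceTime d) → ℝ) (r t : ℝ) : ℝ :=
  1 + ∑' n : ℕ, JTerm ρ r t (n + 1)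

/-- The law on `Bool` giving `true` the probability `q`. -/
def retention (q : unitInterval) : Measure Bool :=
  ENNReal.ofReal (q : ℝ) • Measure.dirac true + ENNReal.ofReal (1 - (q : ℝ)) • Measure.dirac false

instance instIsProbabilityMeasureRetention (q : unitInterval) :
    IsProbabilityMeasure (retention q) := by
  constructor
  simp only [retention, Measure.add_apply, Measure.smul_apply, measure_univ, smul_eq_mul, mul_one]
  rw [← ENNReal.ofReal_add q.2.1 (sub_nonneg.2 q.2.2)]
  simp

/-- `Pth` is the law of the location dependent thinning of a point process with law `P`: given the
configuration `φ`, each point `x` is retained with probability `p x`, independently of the other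
points. -/
def IsThinning (p : SpaceTime d → unitInterval) (P Pth : Measure (Config d)) : Prop :=
  ∀ f : Config d → ℝ≥0∞, Measurable f →
    ∫⁻ ψ, f ψ ∂Pth =
      ∫⁻ φ, ∫⁻ b, f (φ.retain b) ∂(Measure.infinitePi fun x : φ.pts => retention (p x)) ∂P

end STPP

end

/-! Parts 1 to 4 rest on one identity, `IsHardCore.palm_voidSet`. Feed the test function "no points
in `x + C`", for `x` in a fixed ball, to both the Campbell-Mecke formula and the
Georgii-Nguyen-Zessin (GNZ) formula. By stationarity the integrands over the ball are constant, so
`lam` times the Palm void probability of `C` is `β` times the void probability of `C ∪ cyl d RS RT`.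
With `C` empty this gives `β / lam` as the reciprocal of the void probability of the hard core
cylinder. If `C` is a cylinder inside the hard core, the Palm void probability is 1 and `J` is the
reciprocal of a void probability (`J_eq_inv`), hence monotone and at least 1. If `C` contains the
hard core, the void probabilities cancel and `J = β / lam` (`J_eq_div`). Void probabilities of
bounded sets are positive (`measure_voidSet_pos`), and they decrease strictly under suitable
enlargements (`real_voidSet_cyl_lt`).

For the thinned process let `A` be the expectation of the product of `1 - lam_inf / lam_th (x)` over
the points `x` in the cylinder, where `lam_inf` is the infimum of the intensity `lam_th`. Clearly
`A` lies in `[0, 1]`, and it is the alternating series of factorial moments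
(`exists_hasSum_factorialMoments`), with coefficients given by integrals of the normalised product
densities. Splitting a partition at the block of the origin (`normDensity_cons`) and integrating
expresses the integral of the density of `(0, z)` as a binomial convolution of these coefficients
with the `JCoeff`. Inside the hard core this density vanishes as soon as there is a second point, so
the convolution is the unit sequence (`sum_choose_mul_JCoeff`). Multiplying the two absolutely
convergent series gives `JInhom * A = 1`, whence `JInhom ≥ 1`. -/

namespace STPP

variable {d : ℕ}

/-! ### Measurability of sums over the points of a configuration -/

namespace Config

theorem measurableSet_setOf_count {A : Set (SpaceTime d)} (hA : MeasurableSet A) (s : Set ℕ∞) :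
    MeasurableSet {φ : Config d | count A φ ∈ s} :=
  measurable_count hA trivial

theorem count_ne_top (φ : Config d) {B : Set (SpaceTime d)} (hB : Bornology.IsBounded B) :
    count B φ ≠ ⊤ :=
  (φ.locFinite B hB).encard_lt_top.ne

/-- The counting measure of a configuration. -/
noncomputable def pointMeasure (φ : Config d) : Measure (SpaceTime d) :=
  Measure.sum fun x : φ.pts => Measure.dirac (x : SpaceTime d)

theorem lintegral_pointMeasure (φ : Config d) {f : SpaceTime d → ℝ≥0∞} (hf : Measurable f) :
    ∫⁻ x, f x ∂φ.pointMeasure = ∑' x : φ.pts, f x := by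
  simp only [pointMeasure, lintegral_sum_measure]
  exact tsum_congr fun x => lintegral_dirac' _ hf

theorem pointMeasure_apply (φ : Config d) {A : Set (SpaceTime d)} (hA : MeasurableSet A) :
    φ.pointMeasure A = (count A φ : ℝ≥0∞) := by
  classical
  rw [← lintegral_indicator_one hA, lintegral_pointMeasure φ (measurable_one.indicator hA),
    count, ← ENNReal.tsum_set_one, tsum_subtype φ.pts (A.indicator 1),
    tsum_subtype (φ.pts ∩ A) (fun _ => (1 : ℝ≥0∞))]
  refine tsum_congr fun x => ?_
  simp only [Set.indicator, Set.mem_inter_iff, Pi.one_apply]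
  split_ifs <;> simp_all

theorem measurable_pointMeasure : Measurable (pointMeasure (d := d)) := by
  refine Measure.measurable_of_measurable_coe _ fun A hA => ?_
  simp only [pointMeasure_apply _ hA]
  exact (measurable_from_top (f := fun n : ℕ∞ => (n : ℝ≥0∞))).comp (measurable_count hA)

/-- The counting measures of the configurations as a kernel. -/
noncomputable def pointKernel (d : ℕ) : Kernel (Config d) (SpaceTime d) where
  toFun := pointMeasure
  measurable' := measurable_pointMeasure

theorem pointKernel_apply (φ : Config d) : pointKernel d φ = φ.pointMeasure := rfl

/-- Space is cut into bounded shells `A n`, and configurations are sorted by their number `k` of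
points in the shell. On each piece the kernel has total mass at most `k`, so it is finite, and the
pieces add up to the whole kernel. -/
instance isSFiniteKernel_pointKernel : IsSFiniteKernel (pointKernel d) := by
  classical
  set A : ℕ → Set (SpaceTime d) := disjointed fun n : ℕ => Metric.closedBall 0 n with hA
  have hAm : ∀ n, MeasurableSet (A n) := fun n =>
    MeasurableSet.disjointed (fun _ => Metric.isClosed_closedBall.measurableSet) n
  have hAb : ∀ n, Bornology.IsBounded (A n) := fun n =>
    Metric.isBounded_closedBall.subset (disjointed_subset _ n)
  have hU : ⋃ n, A n = Set.univ := by rw [hA, iUnion_disjointed, Metric.iUnion_closedBall_nat]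
  set κ : ℕ → ℕ → Kernel (Config d) (SpaceTime d) := fun n k =>
    Kernel.piecewise (measurableSet_setOf_count (hAm n) {(k : ℕ∞)})
      ((pointKernel d).restrict (hAm n)) 0 with hκ
  have hfin : ∀ n k, IsFiniteKernel (κ n k) := by
    refine fun n k => ⟨⟨k, ENNReal.natCast_lt_top k, fun φ => ?_⟩⟩
    simp only [hκ, Kernel.piecewise_apply]
    split_ifs with h
    · rw [Kernel.restrict_apply, Measure.restrict_apply_univ, pointKernel_apply,
        pointMeasure_apply _ (hAm n)]
      have : count (A n) φ = k := h
      simp [this]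
    · simp
  have h1 : pointKernel d = Kernel.sum fun n => Kernel.sum (κ n) := by
    ext φ : 1
    simp only [Kernel.sum_apply]
    conv_lhs => rw [← Measure.restrict_univ (μ := pointKernel d φ), ← hU,
      Measure.restrict_iUnion (disjoint_disjointed _) hAm]
    congr 1
    funext n
    obtain ⟨k, hk⟩ := ENat.ne_top_iff_exists.1 (count_ne_top φ (hAb n))
    have h2 : ∀ j, κ n j φ = if j = k then (pointKernel d φ).restrict (A n) else 0 := by
      intro j
      simp only [hκ, Kernel.piecewise_apply, Set.mem_singleton_iff, Set.mem_ofPred_eq, ← hk,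
        Nat.cast_inj, eq_comm (a := k)]
      split_ifs <;> simp [Kernel.restrict_apply]
    ext s hs
    simp only [Measure.sum_apply _ hs, h2]
    rw [tsum_eq_single k]
    · rw [if_pos rfl, hA]
    · intro j hj
      simp [hj]
  rw [h1]
  infer_instance

/-- The sum is an integral against an s-finite kernel, so measurability of parametrised kernel
integrals applies. -/
theorem measurable_tsum_pts {Γ : Type*} [MeasurableSpace Γ] {F : Γ × Config d → SpaceTime d → ℝ≥0∞}
    (hF : Measurable (Function.uncurry F)) :
    Measurable fun q : Γ × Config d => ∑' x : q.2.pts, F q x := by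
  have h := hF.lintegral_kernel_prod_right
    (κ := (pointKernel d).comap (Prod.snd : Γ × Config d → Config d) measurable_snd)
  convert! h using 2 with q
  rw [Kernel.comap_apply, pointKernel_apply,
    lintegral_pointMeasure _ (f := F q) (hF.comp measurable_prodMk_left)]

/-- The event says that a sum of indicators over the points vanishes. Joint measurability in
location and configuration is what the Campbell-Mecke formula requires of a test function. -/
theorem measurableSet_translate_disjoint {C : Set (SpaceTime d)} (hC : MeasurableSet C) :
    MeasurableSet {q : SpaceTime d × Config d | q.2.pts ∩ {z | z - q.1 ∈ C} = ∅} := by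
  have h := measurable_tsum_pts (Γ := SpaceTime d)
    (F := fun q z => C.indicator 1 (z - q.1)) (by
      refine (measurable_one.indicator hC).comp ?_
      exact measurable_snd.sub (measurable_fst.comp measurable_fst))
  convert! h (measurableSet_singleton 0) using 1
  ext q
  simp [Set.eq_empty_iff_forall_notMem, Set.indicator]

end Config

/-! ### Sums over tuples of distinct points -/

/-- Split off the first entry of a tuple of pairwise distinct points. -/
theorem distinctSum_succ {n : ℕ} (h : (Fin (n + 1) → SpaceTime d) → ℝ≥0∞) (φ : Config d) :
    distinctSum h φ = reducedSum (fun q => distinctSum (fun z => h (Fin.cons q.1 z)) q.2) φ := by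
  simp only [distinctSum, reducedSum]
  rw [← ENNReal.tsum_sigma (f := fun (x : φ.pts)
    (z : {z : Fin n → SpaceTime d // Function.Injective z ∧ ∀ i, z i ∈ (φ.erase x).pts}) =>
      h (Fin.cons (x : SpaceTime d) (z : Fin n → SpaceTime d)))]
  refine (Equiv.tsum_eq (?_ : (Σ x : φ.pts,
    {z : Fin n → SpaceTime d // Function.Injective z ∧ ∀ i, z i ∈ (φ.erase x).pts}) ≃
    {z : Fin (n + 1) → SpaceTime d // Function.Injective z ∧ ∀ i, z i ∈ φ.pts})
    (fun z => h z)).symm.trans ?_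
  · exact
      { toFun := fun q => ⟨Fin.cons q.1 q.2.1, by
          obtain ⟨⟨x, hx⟩, z, hz, hz'⟩ := q
          refine ⟨Fin.cons_injective_iff.2 ⟨?_, hz⟩, Fin.cases hx fun i => (hz' i).1⟩
          rintro ⟨i, hi⟩
          exact (hz' i).2 hi⟩
        invFun := fun z => ⟨⟨z.1 0, z.2.2 0⟩, Fin.tail z.1, by
          refine ⟨z.2.1.comp (Fin.succ_injective n), fun i => ⟨z.2.2 _, fun hi => ?_⟩⟩
          exact Fin.succ_ne_zero i (z.2.1 hi)⟩
        left_inv := fun q => rfl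
        right_inv := fun z => Subtype.ext (Fin.cons_self_tail z.1) }
  · rfl

theorem distinctSum_zero (h : (Fin 0 → SpaceTime d) → ℝ≥0∞) (φ : Config d) :
    distinctSum h φ = h Fin.elim0 := by
  rw [distinctSum, tsum_eq_single ⟨Fin.elim0, fun i => i.elim0, fun i => i.elim0⟩]
  intro z hz
  exact absurd (Subtype.ext (Subsingleton.elim _ _)) hz

theorem distinctSum_mono {n : ℕ} {h h' : (Fin n → SpaceTime d) → ℝ≥0∞} {φ ψ : Config d}
    (hh : ∀ z, h z ≤ h' z) (hφ : φ.pts ⊆ ψ.pts) : distinctSum h φ ≤ distinctSum h' ψ := by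
  simp only [distinctSum]
  calc _ ≤ ∑' z : {z : Fin n → SpaceTime d // Function.Injective z ∧ ∀ i, z i ∈ φ.pts}, h' z :=
        ENNReal.tsum_le_tsum fun z => hh z
    _ ≤ _ := ENNReal.tsum_comp_le_tsum_of_injective
        (f := fun z : {z : Fin n → SpaceTime d // Function.Injective z ∧ ∀ i, z i ∈ φ.pts} =>
          (⟨z.1, z.2.1, fun i => hφ (z.2.2 i)⟩ :
            {z : Fin n → SpaceTime d // Function.Injective z ∧ ∀ i, z i ∈ ψ.pts}))
        (fun a b hab => Subtype.ext (congrArg (fun z => z.1) hab)) (fun z => h' z)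

-- Trades the erased configuration for an indicator on the tuples, so that measurability need only
-- be studied for a fixed configuration.
open Classical in
theorem distinctSum_erase {n : ℕ} (h : (Fin n → SpaceTime d) → ℝ≥0∞) (φ : Config d)
    (x : SpaceTime d) :
    distinctSum h (φ.erase x) = distinctSum ({z | ∀ i, z i ≠ x}.indicator h) φ := by
  refine (tsum_subtype
    {z : Fin n → SpaceTime d | Function.Injective z ∧ ∀ i, z i ∈ (φ.erase x).pts} h).trans
    (Eq.trans ?_ (tsum_subtype {z : Fin n → SpaceTime d | Function.Injective z ∧ ∀ i, z i ∈ φ.pts}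
      ({z | ∀ i, z i ≠ x}.indicator h)).symm)
  refine tsum_congr fun z => ?_
  have : {z : Fin n → SpaceTime d | Function.Injective z ∧ ∀ i, z i ∈ (φ.erase x).pts} =
      {z : Fin n → SpaceTime d | Function.Injective z ∧ ∀ i, z i ∈ φ.pts} ∩
        {z | ∀ i, z i ≠ x} := by
    ext z
    simp only [Config.erase, Set.mem_ofPred_eq, Set.mem_inter_iff, Set.mem_sdiff,
      Set.mem_singleton_iff, forall_and, and_assoc, ne_eq]
  rw [this, Set.indicator_indicator]

/-- Induction on `n`. The parameter space must vary, because the point that is split off becomes a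
further parameter of the remaining sum. -/
theorem measurable_distinctSum {Γ : Type*} [MeasurableSpace Γ] {n : ℕ}
    {H : Γ × (Fin n → SpaceTime d) → ℝ≥0∞} (hH : Measurable H) :
    Measurable fun q : Γ × Config d => distinctSum (fun z => H (q.1, z)) q.2 := by
  classical
  induction n generalizing Γ with
  | zero =>
    simp only [distinctSum_zero]
    exact hH.comp (measurable_fst.prodMk measurable_const)
  | succ n ih =>
    simp only [distinctSum_succ, reducedSum, distinctSum_erase]
    have h1 : Measurable fun q : (Γ × SpaceTime d) × (Fin n → SpaceTime d) =>
        {w : (Γ × SpaceTime d) × (Fin n → SpaceTime d) | ∀ i, w.2 i ≠ w.1.2}.indicator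
          (fun w => H (w.1.1, (Fin.cons w.1.2 w.2 : Fin (n + 1) → SpaceTime d))) q := by
      refine Measurable.indicator ?_ ?_
      · refine hH.comp ((measurable_fst.comp measurable_fst).prodMk ?_)
        refine measurable_pi_iff.2 (Fin.cases ?_ fun i => ?_)
        · exact measurable_snd.comp measurable_fst
        · exact (measurable_pi_apply i).comp measurable_snd
      · rw [Set.ofPred_forall]
        refine MeasurableSet.iInter fun i => MeasurableSet.compl ?_
        exact measurableSet_eq_fun ((measurable_pi_apply i).comp measurable_snd)
          (measurable_snd.comp measurable_fst)
    have h2 := ih h1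
    refine Config.measurable_tsum_pts (F := fun (q : Γ × Config d) (x : SpaceTime d) =>
      distinctSum ({z | ∀ i, z i ≠ x}.indicator fun z => H (q.1, Fin.cons x z)) q.2) ?_
    exact h2.comp (f := fun q : (Γ × Config d) × SpaceTime d => ((q.1.1, q.2), q.1.2))
      (((measurable_fst.comp measurable_fst).prodMk measurable_snd).prodMk
        (measurable_snd.comp measurable_fst))

theorem measurable_distinctSum_const {n : ℕ} {h : (Fin n → SpaceTime d) → ℝ≥0∞}
    (hh : Measurable h) : Measurable (distinctSum (d := d) h) :=
  (measurable_distinctSum (Γ := Unit) (H := fun q => h q.2) (hh.comp measurable_snd)).comp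
    (measurable_const (a := ()) |>.prodMk measurable_id)

/-! ### Cylinders and void events -/

theorem cyl_eq_prod (d : ℕ) (r t : ℝ) :
    cyl d r t = Metric.closedBall 0 r ×ˢ Metric.closedBall 0 t := by
  ext y
  simp [cyl]

theorem measurableSet_cyl (d : ℕ) (r t : ℝ) : MeasurableSet (cyl d r t) := by
  rw [cyl_eq_prod]
  exact Metric.isClosed_closedBall.measurableSet.prod Metric.isClosed_closedBall.measurableSet

theorem isBounded_cyl (d : ℕ) (r t : ℝ) : Bornology.IsBounded (cyl d r t) := by
  rw [cyl_eq_prod]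
  exact Metric.isBounded_closedBall.prod Metric.isBounded_closedBall

theorem cyl_mono {r t r' t' : ℝ} (hr : r ≤ r') (ht : t ≤ t') : cyl d r t ⊆ cyl d r' t' :=
  fun _ hy => ⟨hy.1.trans hr, hy.2.trans ht⟩

/-- The configurations without points in `C`. -/
def voidSet (C : Set (SpaceTime d)) : Set (Config d) := {φ | φ.pts ∩ C = ∅}

theorem mem_voidSet {C : Set (SpaceTime d)} {φ : Config d} : φ ∈ voidSet C ↔ φ.pts ∩ C = ∅ :=
  Iff.rfl

theorem voidSet_anti {C D : Set (SpaceTime d)} (h : C ⊆ D) : voidSet D ⊆ voidSet C :=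
  fun _ hφ => Set.subset_empty_iff.1 ((Set.inter_subset_inter_right _ h).trans hφ.subset)

theorem voidSet_union (C D : Set (SpaceTime d)) : voidSet (C ∪ D) = voidSet C ∩ voidSet D := by
  ext φ
  simp [mem_voidSet, Set.inter_union_distrib_left]

theorem voidSet_eq_count (C : Set (SpaceTime d)) :
    voidSet C = {φ | Config.count C φ ∈ ({0} : Set ℕ∞)} := by
  ext φ
  simp [mem_voidSet, Config.count]

theorem measurableSet_voidSet {C : Set (SpaceTime d)} (hC : MeasurableSet C) :
    MeasurableSet (voidSet C) := by
  rw [voidSet_eq_count]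
  exact Config.measurableSet_setOf_count hC _

theorem measurableSet_voidSet_translate {C : Set (SpaceTime d)} (hC : MeasurableSet C)
    (x : SpaceTime d) : MeasurableSet (voidSet {z | z - x ∈ C}) :=
  measurableSet_voidSet (hC.preimage (measurable_sub_const x))

theorem translate_mem_voidSet (C : Set (SpaceTime d)) (x : SpaceTime d) (φ : Config d) :
    Config.translate x φ ∈ voidSet {z | z - x ∈ C} ↔ φ ∈ voidSet C := by
  simp only [mem_voidSet, Set.eq_empty_iff_forall_notMem, Set.mem_inter_iff, not_and]
  constructor
  · intro h y hy hyC
    refine h (y + x) ?_ ?_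
    · simpa [Config.translate] using hy
    · simpa using hyC
  · exact fun h y hy => h _ hy

theorem map_translate_voidSet (Q : Measure (Config d)) {C : Set (SpaceTime d)}
    (hC : MeasurableSet C) (x : SpaceTime d) :
    Q.map (Config.translate x) (voidSet {z | z - x ∈ C}) = Q (voidSet C) := by
  rw [Measure.map_apply (Config.measurable_translate x)
    (measurableSet_voidSet_translate hC x)]
  congr 1
  ext φ
  exact translate_mem_voidSet C x φ

theorem IsStationary.voidSet_translate {P : Measure (Config d)} (hP : IsStationary P)
    {C : Set (SpaceTime d)} (hC : MeasurableSet C) (x : SpaceTime d) :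
    P (voidSet {z | z - x ∈ C}) = P (voidSet C) := by
  conv_lhs => rw [← hP x]
  exact map_translate_voidSet P hC x

theorem one_sub_hitProb (Q : Measure (Config d)) [IsProbabilityMeasure Q] (r t : ℝ) :
    1 - hitProb Q r t = Q.real (voidSet (cyl d r t)) := by
  have h : {φ : Config d | (φ.pts ∩ cyl d r t).Nonempty} = (voidSet (cyl d r t))ᶜ := by
    ext φ
    simp [mem_voidSet, Set.nonempty_iff_ne_empty]
  rw [hitProb, h, probReal_compl_eq_one_sub (measurableSet_voidSet (measurableSet_cyl d r t))]
  ring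

theorem ofReal_hardCoreIntensity (β RS RT : ℝ) (x : SpaceTime d) (φ : Config d) :
    ENNReal.ofReal (hardCoreIntensity β RS RT (x, φ)) =
      (voidSet {z | z - x ∈ cyl d RS RT}).indicator (fun _ => ENNReal.ofReal β) φ := by
  classical
  simp only [hardCoreIntensity, Set.indicator, mem_voidSet]
  split_ifs <;> simp

theorem le_reducedSum_of_mem {g : SpaceTime d × Config d → ℝ≥0∞} {φ : Config d} {x : SpaceTime d}
    (hx : x ∈ φ.pts) : g (x, φ.erase x) ≤ reducedSum g φ :=
  ENNReal.le_tsum (f := fun x : φ.pts => g (x, φ.erase x)) ⟨x, hx⟩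

/-! ### Void probabilities from the GNZ formula -/

namespace IsHardCore

variable {β RS RT : ℝ} {P : Measure (Config d)}

theorem gnz (hP : IsHardCore β RS RT P) {g : SpaceTime d × Config d → ℝ≥0∞} (hg : Measurable g) :
    ∫⁻ φ, reducedSum g φ ∂P = ENNReal.ofReal β *
      ∫⁻ x, ∫⁻ φ in voidSet {z | z - x ∈ cyl d RS RT}, g (x, φ) ∂P := by
  rw [hP.papangelou.gnz g hg, ← lintegral_const_mul' _ _ ENNReal.ofReal_ne_top]
  refine lintegral_congr fun x => ?_
  have hm := measurableSet_voidSet_translate (measurableSet_cyl d RS RT) x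
  rw [← lintegral_const_mul' _ _ ENNReal.ofReal_ne_top, ← lintegral_indicator hm]
  refine lintegral_congr fun φ => ?_
  rw [ofReal_hardCoreIntensity]
  by_cases h : φ ∈ voidSet {z | z - x ∈ cyl d RS RT}
  · rw [Set.indicator_of_mem h, Set.indicator_of_mem (by exact h), mul_comm]
  · rw [Set.indicator_of_notMem h, Set.indicator_of_notMem (by exact h), mul_zero]

theorem gnz_le (hP : IsHardCore β RS RT P) {g : SpaceTime d × Config d → ℝ≥0∞}
    (hg : Measurable g) :
    ∫⁻ φ, reducedSum g φ ∂P ≤ ENNReal.ofReal β * ∫⁻ x, ∫⁻ φ, g (x, φ) ∂P := by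
  rw [hP.gnz hg]
  gcongr with x
  exact Measure.restrict_le_self

/-- If having no points in `B` were a null event, then so would be having exactly `n` points, for
every `n`: removing one of `n + 1` points leaves `n`, and the GNZ formula bounds the larger event by
the smaller. As `B` is bounded, these events exhaust the whole space. -/
theorem measure_voidSet_pos [IsProbabilityMeasure P] (hP : IsHardCore β RS RT P)
    {B : Set (SpaceTime d)} (hB : MeasurableSet B) (hb : Bornology.IsBounded B) :
    0 < P (voidSet B) := by
  rw [pos_iff_ne_zero]
  intro h0
  have hm : ∀ n : ℕ, MeasurableSet {φ : Config d | Config.count B φ ∈ ({(n : ℕ∞)} : Set ℕ∞)} :=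
    fun n => Config.measurableSet_setOf_count hB _
  have key : ∀ n : ℕ, P {φ | Config.count B φ ∈ ({(n : ℕ∞)} : Set ℕ∞)} = 0 := by
    intro n
    induction n with
    | zero => rwa [voidSet_eq_count] at h0
    | succ n ih =>
      set N := {φ : Config d | Config.count B φ ∈ ({(n : ℕ∞)} : Set ℕ∞)}
      -- The test function counts the points of `B` whose removal leaves exactly `n` points in `B`.
      have hg : Measurable ((B ×ˢ N).indicator (1 : SpaceTime d × Config d → ℝ≥0∞)) :=
        measurable_one.indicator (hB.prod (hm n))
      have h1 := hP.gnz_le hg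
      have h2 : ∀ x : SpaceTime d,
          ∫⁻ φ, (B ×ˢ N).indicator (1 : SpaceTime d × Config d → ℝ≥0∞) (x, φ) ∂P = 0 := by
        intro x
        refine le_antisymm ?_ bot_le
        calc _ ≤ ∫⁻ φ, N.indicator 1 φ ∂P := by
              refine lintegral_mono fun φ => ?_
              by_cases h : φ ∈ N
              · simp only [Set.indicator_of_mem h]
                exact Set.indicator_le_self' (by simp) _
              · rw [Set.indicator_of_notMem (fun h' => h h'.2)]
                exact bot_le
          _ = 0 := by rw [lintegral_indicator_one (hm n), ih]
      simp only [h2, lintegral_zero, mul_zero] at h1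
      refine le_antisymm (le_trans ?_ h1) bot_le
      rw [← lintegral_indicator_one (hm (n + 1))]
      refine lintegral_mono fun φ => ?_
      by_cases h : φ ∈ {φ : Config d | Config.count B φ ∈ ({((n + 1 : ℕ) : ℕ∞)} : Set ℕ∞)}
      · rw [Set.indicator_of_mem h]
        have h' : Config.count B φ = n + 1 := by simpa using h
        have hne : (φ.pts ∩ B).Nonempty := by
          rw [← Set.encard_ne_zero]
          change Config.count B φ ≠ 0
          rw [h']
          exact ne_of_gt (by positivity)
        obtain ⟨x, hx, hxB⟩ := hne
        refine le_trans (le_of_eq ?_) (le_reducedSum_of_mem hx)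
        rw [Set.indicator_of_mem]
        · rfl
        · refine ⟨hxB, ?_⟩
          have h3 : ((φ.erase x).pts ∩ B).encard + 1 = (φ.pts ∩ B).encard := by
            have : (φ.erase x).pts ∩ B = (φ.pts ∩ B) \ {x} := by
              ext y
              simp only [Config.erase, Set.mem_inter_iff, Set.mem_sdiff]
              tauto
            rw [this]
            exact Set.encard_sdiff_singleton_add_one ⟨hx, hxB⟩
          change Config.count B (φ.erase x) = n
          have h4 : Config.count B (φ.erase x) + 1 = n + 1 := h3.trans h'
          exact (ENat.add_left_injective_of_ne_top (by simp)) h4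
      · rw [Set.indicator_of_notMem h]
        exact bot_le
  have hU : (Set.univ : Set (Config d)) =
      ⋃ n : ℕ, {φ | Config.count B φ ∈ ({(n : ℕ∞)} : Set ℕ∞)} := by
    ext φ
    obtain ⟨n, hn⟩ := ENat.ne_top_iff_exists.1 (Config.count_ne_top φ hb)
    simp only [Set.mem_univ, Set.mem_iUnion, true_iff]
    exact ⟨n, hn.symm⟩
  have h1 : P Set.univ = 0 := by
    rw [hU]
    exact measure_iUnion_null key
  simp at h1

/-- The void probabilities of the reduced Palm distribution. -/
theorem palm_voidSet (hP : IsHardCore β RS RT P) {lam : ℝ}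
    {K : Kernel (SpaceTime d) (Config d)} (hK : IsReducedPalm P (fun _ => lam) K)
    (hK0 : ∀ a, K a = (K 0).map (Config.translate a)) {C : Set (SpaceTime d)}
    (hC : MeasurableSet C) :
    ENNReal.ofReal lam * K 0 (voidSet C) =
      ENNReal.ofReal β * P (voidSet (C ∪ cyl d RS RT)) := by
  -- Any measurable set of positive finite volume would do: its volume appears on both sides and is
  -- cancelled at the end.
  set B : Set (SpaceTime d) := Metric.closedBall 0 1
  have hB : MeasurableSet B := Metric.isClosed_closedBall.measurableSet
  have hB0 : volume B ≠ 0 := (Metric.measure_closedBall_pos volume 0 one_pos).ne'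
  have hB1 : volume B ≠ ∞ := measure_closedBall_lt_top.ne
  set A : Set (SpaceTime d × Config d) := {q | q.1 ∈ B ∧ q.2.pts ∩ {z | z - q.1 ∈ C} = ∅}
  have hA : MeasurableSet A :=
    (hB.preimage measurable_fst).inter (Config.measurableSet_translate_disjoint hC)
  have hg : Measurable (A.indicator (1 : SpaceTime d × Config d → ℝ≥0∞)) :=
    measurable_one.indicator hA
  have h0 : ∀ (Q : Measure (Config d)) (x : SpaceTime d),
      ∫⁻ φ, A.indicator (1 : SpaceTime d × Config d → ℝ≥0∞) (x, φ) ∂Q =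
        B.indicator (fun _ => Q (voidSet {z | z - x ∈ C})) x := by
    intro Q x
    have hm := measurableSet_voidSet_translate hC x
    by_cases hx : x ∈ B
    · rw [Set.indicator_of_mem hx]
      refine Eq.trans (lintegral_congr fun φ => ?_) (lintegral_indicator_one hm)
      by_cases hφ : φ ∈ voidSet {z | z - x ∈ C}
      · rw [Set.indicator_of_mem (show (x, φ) ∈ A from ⟨hx, hφ⟩),
          Set.indicator_of_mem (by exact hφ)]
        rfl
      · rw [Set.indicator_of_notMem (fun h : (x, φ) ∈ A => hφ h.2),
          Set.indicator_of_notMem (by exact hφ)]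
    · rw [Set.indicator_of_notMem hx]
      refine (lintegral_congr fun φ => ?_).trans lintegral_zero
      exact Set.indicator_of_notMem (fun h : (x, φ) ∈ A => hx h.1) _
  have h1 := hK _ hg
  rw [hP.gnz hg] at h1
  have h2 : ∀ x, ∫⁻ φ, A.indicator (1 : SpaceTime d × Config d → ℝ≥0∞) (x, φ) ∂(K x) =
      B.indicator (fun _ => K 0 (voidSet C)) x := by
    intro x
    rw [h0, hK0 x]
    simp only [map_translate_voidSet _ hC]
  have h3 : ∀ x, ∫⁻ φ in voidSet {z | z - x ∈ cyl d RS RT},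
      A.indicator (1 : SpaceTime d × Config d → ℝ≥0∞) (x, φ) ∂P =
        B.indicator (fun _ => P (voidSet (C ∪ cyl d RS RT))) x := by
    intro x
    have hm := measurableSet_voidSet_translate hC x
    rw [h0]
    congr 1
    funext _
    rw [Measure.restrict_apply hm, ← hP.stationary.voidSet_translate
      (hC.union (measurableSet_cyl d RS RT)) x]
    have : {z | z - x ∈ C ∪ cyl d RS RT} = {z | z - x ∈ C} ∪ {z | z - x ∈ cyl d RS RT} := rfl
    rw [this, voidSet_union]
  simp only [h2, h3] at h1
  rw [lintegral_mul_const' _ _ ENNReal.ofReal_ne_top, lintegral_indicator_const hB,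
    lintegral_indicator_const hB] at h1
  refine (ENNReal.mul_left_inj hB0 hB1).1 ?_
  rw [mul_assoc (ENNReal.ofReal β), h1]
  ring

end IsHardCore

theorem voidSet_empty : voidSet (∅ : Set (SpaceTime d)) = Set.univ := by
  ext φ
  simp [mem_voidSet]

/-- Growth in the time direction suffices: the difference contains the open box of locations in
`ball 0 R` and times strictly between `t` and `T`. -/
theorem volume_cyl_sdiff_pos {r t R T : ℝ} (hR : 0 < R) (ht : 0 ≤ t) (hT : t < T) :
    0 < volume (cyl d R T \ cyl d r t) := by
  have hU : (Metric.ball 0 R ×ˢ Set.Ioo t T : Set (SpaceTime d)) ⊆ cyl d R T \ cyl d r t := by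
    rintro ⟨x, s⟩ ⟨hx, hs⟩
    have hs0 : |s| = s := abs_of_pos (ht.trans_lt hs.1)
    refine ⟨⟨(mem_ball_zero_iff.1 hx).le, ?_⟩, fun h => ?_⟩
    · simpa only [hs0] using hs.2.le
    · exact absurd (hs0.symm.le.trans h.2) (not_le.2 hs.1)
  refine lt_of_lt_of_le (IsOpen.measure_pos volume (Metric.isOpen_ball.prod isOpen_Ioo) ?_)
    (measure_mono hU)
  exact ⟨(0, (t + T) / 2), Metric.mem_ball_self hR, by constructor <;> linarith⟩

/-! ### The stationary J-function -/

namespace IsHardCore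

variable {β RS RT lam : ℝ} {P : Measure (Config d)}
  {K : Kernel (SpaceTime d) (Config d)} [IsMarkovKernel K]

theorem ofReal_intensity (hP : IsHardCore β RS RT P) (hK : IsReducedPalm P (fun _ => lam) K)
    (hK0 : ∀ a, K a = (K 0).map (Config.translate a)) :
    ENNReal.ofReal lam = ENNReal.ofReal β * P (voidSet (cyl d RS RT)) := by
  have h := hP.palm_voidSet hK hK0 MeasurableSet.empty
  simpa [voidSet_empty] using h

variable [IsProbabilityMeasure P]

theorem real_voidSet_pos (hP : IsHardCore β RS RT P)
    {B : Set (SpaceTime d)} (hB : MeasurableSet B) (hb : Bornology.IsBounded B) :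
    0 < P.real (voidSet B) :=
  ENNReal.toReal_pos (hP.measure_voidSet_pos hB hb).ne' (measure_ne_top _ _)

theorem hitProb_ne_one (hP : IsHardCore β RS RT P) (r t : ℝ) : hitProb P r t ≠ 1 := by
  have h1 := hP.real_voidSet_pos (measurableSet_cyl d r t) (isBounded_cyl d r t)
  rw [← one_sub_hitProb] at h1
  linarith

theorem intensity_pos (hP : IsHardCore β RS RT P) (hβ : 0 < β)
    (hK : IsReducedPalm P (fun _ => lam) K) (hK0 : ∀ a, K a = (K 0).map (Config.translate a)) :
    0 < lam := by
  rw [← ENNReal.ofReal_pos, hP.ofReal_intensity hK hK0]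
  exact ENNReal.mul_pos (ENNReal.ofReal_pos.2 hβ).ne'
    (hP.measure_voidSet_pos (measurableSet_cyl d RS RT) (isBounded_cyl d RS RT)).ne'

theorem palm_real_voidSet (hP : IsHardCore β RS RT P) (hβ : 0 < β)
    (hK : IsReducedPalm P (fun _ => lam) K) (hK0 : ∀ a, K a = (K 0).map (Config.translate a))
    {C : Set (SpaceTime d)} (hC : MeasurableSet C) :
    lam * (K 0).real (voidSet C) = β * P.real (voidSet (C ∪ cyl d RS RT)) := by
  have h := congrArg ENNReal.toReal (hP.palm_voidSet hK hK0 hC)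
  rwa [ENNReal.toReal_mul, ENNReal.toReal_mul, ENNReal.toReal_ofReal hβ.le,
    ENNReal.toReal_ofReal (hP.intensity_pos hβ hK hK0).le] at h

theorem intensity_eq (hP : IsHardCore β RS RT P) (hβ : 0 < β)
    (hK : IsReducedPalm P (fun _ => lam) K) (hK0 : ∀ a, K a = (K 0).map (Config.translate a)) :
    lam = β * P.real (voidSet (cyl d RS RT)) := by
  have h := hP.palm_real_voidSet hβ hK hK0 MeasurableSet.empty
  simpa [voidSet_empty] using h

theorem div_intensity (hP : IsHardCore β RS RT P) (hβ : 0 < β)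
    (hK : IsReducedPalm P (fun _ => lam) K) (hK0 : ∀ a, K a = (K 0).map (Config.translate a)) :
    β / lam = (P.real (voidSet (cyl d RS RT)))⁻¹ := by
  have h := hP.real_voidSet_pos (measurableSet_cyl d RS RT) (isBounded_cyl d RS RT)
  rw [hP.intensity_eq hβ hK hK0]
  field_simp

/-- Inside the hard core the union with `cyl d RS RT` is that cylinder itself, so the Palm void
probability, the numerator of `J`, equals 1. -/
theorem J_eq_inv (hP : IsHardCore β RS RT P) (hβ : 0 < β)
    (hK : IsReducedPalm P (fun _ => lam) K) (hK0 : ∀ a, K a = (K 0).map (Config.translate a))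
    {r t : ℝ} (hr : r ≤ RS) (ht : t ≤ RT) :
    J P (K 0) r t = (P.real (voidSet (cyl d r t)))⁻¹ := by
  have hl := hP.intensity_pos hβ hK hK0
  have h := hP.palm_real_voidSet hβ hK hK0 (measurableSet_cyl d r t)
  rw [Set.union_eq_right.2 (cyl_mono hr ht), ← hP.intensity_eq hβ hK hK0] at h
  rw [J, one_sub_hitProb, one_sub_hitProb, mul_left_cancel₀ hl.ne' (h.trans (mul_one _).symm),
    one_div]

theorem J_eq_div (hP : IsHardCore β RS RT P) (hβ : 0 < β)
    (hK : IsReducedPalm P (fun _ => lam) K) (hK0 : ∀ a, K a = (K 0).map (Config.translate a))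
    {r t : ℝ} (hr : RS ≤ r) (ht : RT ≤ t) : J P (K 0) r t = β / lam := by
  have hl := hP.intensity_pos hβ hK hK0
  have h := hP.palm_real_voidSet hβ hK hK0 (measurableSet_cyl d r t)
  rw [Set.union_eq_left.2 (cyl_mono hr ht)] at h
  have hv := hP.real_voidSet_pos (measurableSet_cyl d r t) (isBounded_cyl d r t)
  rw [J, one_sub_hitProb, one_sub_hitProb, div_eq_div_iff hv.ne' hl.ne', mul_comm, h]

theorem real_voidSet_cyl_anti {r t r' t' : ℝ} (hr : r ≤ r') (ht : t ≤ t') :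
    P.real (voidSet (cyl d r' t')) ≤ P.real (voidSet (cyl d r t)) :=
  measureReal_mono (voidSet_anti (cyl_mono hr ht))

theorem J_mono (hP : IsHardCore β RS RT P) (hβ : 0 < β)
    (hK : IsReducedPalm P (fun _ => lam) K) (hK0 : ∀ a, K a = (K 0).map (Config.translate a))
    {r t r' t' : ℝ} (hr : r ≤ r') (ht : t ≤ t') (hr' : r' ≤ RS) (ht' : t' ≤ RT) :
    J P (K 0) r t ≤ J P (K 0) r' t' := by
  rw [hP.J_eq_inv hβ hK hK0 (hr.trans hr') (ht.trans ht'), hP.J_eq_inv hβ hK hK0 hr' ht']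
  exact inv_anti₀ (hP.real_voidSet_pos (measurableSet_cyl d _ _) (isBounded_cyl d _ _))
    (real_voidSet_cyl_anti hr ht)

theorem one_le_J (hP : IsHardCore β RS RT P) (hβ : 0 < β)
    (hK : IsReducedPalm P (fun _ => lam) K) (hK0 : ∀ a, K a = (K 0).map (Config.translate a))
    {r t : ℝ} (hr : r ≤ RS) (ht : t ≤ RT) : 1 ≤ J P (K 0) r t := by
  rw [hP.J_eq_inv hβ hK hK0 hr ht]
  exact (one_le_inv₀ (hP.real_voidSet_pos (measurableSet_cyl d _ _) (isBounded_cyl d _ _))).2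
    measureReal_le_one

/-- With positive probability there are points in the larger but none in the smaller cylinder. -/
theorem real_voidSet_cyl_lt (hP : IsHardCore β RS RT P) (hβ : 0 < β) {r t R T : ℝ}
    (hR : 0 < R) (ht : 0 ≤ t) (hr : r ≤ R) (hT : t < T) :
    P.real (voidSet (cyl d R T)) < P.real (voidSet (cyl d r t)) := by
  refine lt_of_le_of_ne (real_voidSet_cyl_anti hr hT.le) fun heq => ?_
  have hmR := measurableSet_cyl d R T
  have hmr := measurableSet_cyl d r t
  have h0 : P (voidSet (cyl d r t) \ voidSet (cyl d R T)) = 0 := by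
    rw [measure_sdiff (voidSet_anti (cyl_mono hr hT.le))
      (measurableSet_voidSet hmR).nullMeasurableSet (measure_ne_top _ _),
      (measureReal_eq_measureReal_iff).1 heq, tsub_self]
  -- The test function detects a point of the shell that is the only point in the large cylinder.
  -- Such a configuration is void on the small cylinder but not on the large one, hence lies in the
  -- null event `h0`.
  set A : Set (SpaceTime d × Config d) :=
    (cyl d R T \ cyl d r t) ×ˢ voidSet (cyl d R T) with hA
  have hg : Measurable (A.indicator (1 : SpaceTime d × Config d → ℝ≥0∞)) :=
    measurable_one.indicator ((hmR.diff hmr).prod (measurableSet_voidSet hmR))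
  have h1 : ∫⁻ φ, reducedSum (A.indicator 1) φ ∂P = 0 := by
    refine lintegral_eq_zero_of_ae_eq_zero ?_
    filter_upwards [measure_eq_zero_iff_ae_notMem.1 h0] with φ hφ
    refine ENNReal.tsum_eq_zero.2 fun x => Set.indicator_of_notMem (fun hx => hφ ⟨?_, ?_⟩) _
    · have h2 := Set.eq_empty_iff_forall_notMem.1 (mem_voidSet.1 hx.2)
      refine Set.eq_empty_iff_forall_notMem.2 fun y hy => h2 y ⟨⟨hy.1, ?_⟩, cyl_mono hr hT.le hy.2⟩
      rintro rfl
      exact hx.1.2 hy.2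
    · intro h2
      exact Set.eq_empty_iff_forall_notMem.1 (mem_voidSet.1 h2) x ⟨x.2, hx.1.1⟩
  rw [hP.gnz hg, mul_eq_zero] at h1
  have h2 := h1.resolve_left (ENNReal.ofReal_pos.2 hβ).ne'
  -- By the triangle inequality `V` covers the hard core around every `x` in the large cylinder. A
  -- void `V` therefore bounds the inner GNZ integral from below by one positive constant on the
  -- whole shell, contradicting its vanishing integral.
  set V : Set (SpaceTime d) := cyl d (R + RS) (T + RT) ∪ cyl d R T
  have hV : 0 < P (voidSet V) := hP.measure_voidSet_pos
    ((measurableSet_cyl d _ _).union hmR) ((isBounded_cyl d _ _).union (isBounded_cyl d _ _))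
  have h3 : (cyl d R T \ cyl d r t).indicator (fun _ => P (voidSet V)) ≤ fun x =>
      ∫⁻ φ in voidSet {z | z - x ∈ cyl d RS RT}, A.indicator 1 (x, φ) ∂P := by
    intro x
    by_cases hx : x ∈ cyl d R T \ cyl d r t
    · rw [Set.indicator_of_mem hx]
      have hm := measurableSet_voidSet_translate (measurableSet_cyl d RS RT) x
      have h4 : voidSet V ⊆ voidSet (cyl d R T) ∩ voidSet {z | z - x ∈ cyl d RS RT} := by
        rw [← voidSet_union]
        refine voidSet_anti (Set.union_subset Set.subset_union_right fun z hz => Or.inl ⟨?_, ?_⟩)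
        · have := norm_add_le x.1 (z - x).1
          rw [← Prod.fst_add, add_sub_cancel] at this
          linarith [hx.1.1, hz.1]
        · have := abs_add_le x.2 (z - x).2
          rw [← Prod.snd_add, add_sub_cancel] at this
          linarith [hx.1.2, hz.2]
      refine (measure_mono h4).trans ?_
      rw [← Measure.restrict_apply (measurableSet_voidSet hmR),
        ← lintegral_indicator_one (measurableSet_voidSet hmR)]
      refine le_of_eq (lintegral_congr fun φ => ?_)
      by_cases hφ : φ ∈ voidSet (cyl d R T)
      · rw [Set.indicator_of_mem hφ, Set.indicator_of_mem (show (x, φ) ∈ A from ⟨hx, hφ⟩)]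
        rfl
      · rw [Set.indicator_of_notMem hφ, Set.indicator_of_notMem (fun h : (x, φ) ∈ A => hφ h.2)]
    · rw [Set.indicator_of_notMem hx]
      exact bot_le
  have h5 := (lintegral_mono h3).trans h2.le
  rw [lintegral_indicator_const (hmR.diff hmr)] at h5
  exact (ENNReal.mul_pos hV.ne' (volume_cyl_sdiff_pos hR ht hT).ne').not_ge h5

end IsHardCore

/-! ### Factorial moments and generating functionals -/

theorem measurePreserving_cons (E : Type*) [MeasurableSpace E] (μ : Measure E)
    [SigmaFinite μ] (n : ℕ) :
    MeasurePreserving (fun q : E × (Fin n → E) => (Fin.cons q.1 q.2 : Fin (n + 1) → E))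
      (μ.prod (Measure.pi fun _ => μ)) (Measure.pi fun _ => μ) := by
  have h := (measurePreserving_piFinSuccAbove (fun _ : Fin (n + 1) => μ) 0).symm
  convert! h using 1
  funext q
  exact (Fin.insertNth_zero' q.1 q.2).symm

theorem measurable_cons {E : Type*} [MeasurableSpace E] (n : ℕ) :
    Measurable fun q : E × (Fin n → E) => (Fin.cons q.1 q.2 : Fin (n + 1) → E) := by
  refine measurable_pi_iff.2 (Fin.cases ?_ fun i => ?_)
  · exact measurable_fst
  · exact (measurable_pi_apply i).comp measurable_snd

theorem measurable_distinctSum_cons {n : ℕ} {h : (Fin (n + 1) → SpaceTime d) → ℝ≥0∞}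
    (hh : Measurable h) :
    Measurable fun q : SpaceTime d × Config d =>
      distinctSum (fun z => h (Fin.cons q.1 z)) q.2 :=
  measurable_distinctSum (H := fun q : SpaceTime d × (Fin n → SpaceTime d) =>
    h (Fin.cons q.1 q.2)) (hh.comp (measurable_cons n))

namespace IsHardCore

variable {β RS RT : ℝ} {P : Measure (Config d)}

/-- The factorial moment measures are dominated by multiples of Lebesgue measure. -/
theorem lintegral_distinctSum_le [IsProbabilityMeasure P] (hP : IsHardCore β RS RT P) {n : ℕ}
    {h : (Fin n → SpaceTime d) → ℝ≥0∞} (hh : Measurable h) :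
    ∫⁻ φ, distinctSum h φ ∂P ≤ ENNReal.ofReal β ^ n * ∫⁻ z, h z := by
  induction n with
  | zero =>
    simp only [distinctSum_zero, lintegral_const, measure_univ, mul_one, pow_zero, one_mul]
    rw [volume_pi, Measure.pi_of_empty _ Fin.elim0, lintegral_dirac' _ hh]
  | succ n ih =>
    simp only [distinctSum_succ]
    have h1 := (measurePreserving_cons (SpaceTime d) volume n).lintegral_comp hh
    rw [lintegral_prod (fun q => h (Fin.cons q.1 q.2))
      (hh.comp (measurable_cons n)).aemeasurable] at h1
    refine (hP.gnz_le (measurable_distinctSum_cons hh)).trans ?_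
    rw [volume_pi, ← h1, pow_succ', mul_assoc]
    gcongr
    rw [← lintegral_const_mul' _ _ (ENNReal.pow_ne_top ENNReal.ofReal_ne_top)]
    refine lintegral_mono fun x => ?_
    exact ih (hh.comp ((measurable_cons n).comp measurable_prodMk_left))

/-- There are no two points at a distance within the hard core. -/
theorem lintegral_distinctSum_eq_zero (hP : IsHardCore β RS RT P) {n : ℕ}
    {h : (Fin (n + 2) → SpaceTime d) → ℝ≥0∞} (hh : Measurable h)
    (h0 : ∀ z, z 1 - z 0 ∉ cyl d RS RT → h z = 0) :
    ∫⁻ φ, distinctSum h φ ∂P = 0 := by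
  simp only [distinctSum_succ h]
  rw [hP.gnz (measurable_distinctSum_cons hh), mul_eq_zero]
  refine Or.inr ((lintegral_congr fun x => ?_).trans lintegral_zero)
  refine setLIntegral_eq_zero (measurableSet_voidSet_translate (measurableSet_cyl d RS RT) x) ?_
  intro φ hφ
  -- A nonzero term would need its second point `z.1 0` in the hard core of `x`, where `φ` is void.
  refine ENNReal.tsum_eq_zero.2 fun z => h0 _ fun hz => ?_
  exact Set.eq_empty_iff_forall_notMem.1 (mem_voidSet.1 hφ) (z.1 0) ⟨z.2.2 0, hz⟩

end IsHardCore

/-- The retained points form a subset whatever the coin tosses, so the sum can only drop. Thus both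
the moment bounds and the hard core pass to the thinning. -/
theorem IsThinning.lintegral_distinctSum_le {p : SpaceTime d → unitInterval}
    {P Pth : Measure (Config d)} (h : IsThinning p P Pth) {n : ℕ}
    {f : (Fin n → SpaceTime d) → ℝ≥0∞} (hf : Measurable f) :
    ∫⁻ ψ, distinctSum f ψ ∂Pth ≤ ∫⁻ φ, distinctSum f φ ∂P := by
  rw [h _ (measurable_distinctSum_const hf)]
  refine lintegral_mono fun φ => ?_
  calc _ ≤ ∫⁻ _, distinctSum f φ ∂(Measure.infinitePi fun x : φ.pts => retention (p x)) :=
        lintegral_mono fun b => distinctSum_mono (φ := φ.retain b) (fun _ => le_rfl)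
          fun y hy => hy.1
    _ = distinctSum f φ := by simp

/-- Double counting: a point together with an `n`-set avoiding it is an `(n + 1)`-set with a marked
element, and there are `n + 1` ways to mark. -/
theorem sum_mul_sum_powersetCard_erase {α R : Type*} [DecidableEq α] [CommSemiring R] (w : α → R)
    (F : Finset α) (n : ℕ) :
    ∑ x ∈ F, w x * ∑ T ∈ (F.erase x).powersetCard n, ∏ y ∈ T, w y =
      (n + 1) * ∑ U ∈ F.powersetCard (n + 1), ∏ y ∈ U, w y := by
  have h1 : (n + 1) * ∑ U ∈ F.powersetCard (n + 1), ∏ y ∈ U, w y =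
      ∑ U ∈ F.powersetCard (n + 1), ∑ _x ∈ U, ∏ y ∈ U, w y := by
    rw [Finset.mul_sum]
    refine Finset.sum_congr rfl fun U hU => ?_
    rw [Finset.sum_const, (Finset.mem_powersetCard.1 hU).2]
    simp
  simp only [h1, Finset.mul_sum, Finset.sum_sigma']
  refine Finset.sum_nbij' (fun q => ⟨insert q.1 q.2, q.1⟩) (fun q => ⟨q.2, q.1.erase q.2⟩)
    ?_ ?_ ?_ ?_ ?_
  · rintro ⟨x, T⟩ h
    simp only [Finset.mem_sigma, Finset.mem_powersetCard] at h ⊢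
    have hx : x ∉ T := fun hx => Finset.notMem_erase x F (h.2.1 hx)
    refine ⟨⟨Finset.insert_subset h.1 (h.2.1.trans (Finset.erase_subset _ _)), ?_⟩,
      Finset.mem_insert_self _ _⟩
    rw [Finset.card_insert_of_notMem hx, h.2.2]
  · rintro ⟨U, x⟩ h
    simp only [Finset.mem_sigma, Finset.mem_powersetCard] at h ⊢
    refine ⟨h.1.1 h.2, Finset.erase_subset_erase _ h.1.1, ?_⟩
    rw [Finset.card_erase_of_mem h.2, h.1.2, Nat.add_sub_cancel]
  · rintro ⟨x, T⟩ h
    simp only [Finset.mem_sigma, Finset.mem_powersetCard] at h ⊢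
    have hx : x ∉ T := fun hx => Finset.notMem_erase x F (h.2.1 hx)
    simp [Finset.erase_insert hx]
  · rintro ⟨U, x⟩ h
    simp only [Finset.mem_sigma, Finset.mem_powersetCard] at h ⊢
    simp [Finset.insert_erase h.2]
  · rintro ⟨x, T⟩ h
    simp only [Finset.mem_sigma, Finset.mem_powersetCard] at h ⊢
    have hx : x ∉ T := fun hx => Finset.notMem_erase x F (h.2.1 hx)
    rw [Finset.prod_insert hx]

/-- For product functions the sum over tuples is an elementary symmetric polynomial. -/
theorem distinctSum_prod (w : SpaceTime d → ℝ≥0∞) (n : ℕ) (φ : Config d)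
    (F : Finset (SpaceTime d)) (hF : ∀ x, x ∈ F → x ∈ φ.pts)
    (hw : ∀ x ∈ φ.pts, x ∉ F → w x = 0) :
    distinctSum (fun z : Fin n → SpaceTime d => ∏ i, w (z i)) φ =
      n.factorial * ∑ T ∈ F.powersetCard n, ∏ x ∈ T, w x := by
  classical
  induction n generalizing φ F with
  | zero => simp [distinctSum_zero]
  | succ n ih =>
    have h1 : ∀ x ∈ F, distinctSum (fun z : Fin n → SpaceTime d => ∏ i, w (z i)) (φ.erase x) =
        n.factorial * ∑ T ∈ (F.erase x).powersetCard n, ∏ x ∈ T, w x := by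
      refine fun x hx => ih (φ.erase x) (F.erase x) (fun y hy => ?_) fun y hy hyF => ?_
      · exact ⟨hF y (Finset.mem_of_mem_erase hy), Finset.ne_of_mem_erase hy⟩
      · exact hw y hy.1 fun h => hyF (Finset.mem_erase.2 ⟨hy.2, h⟩)
    have h2 : ∀ x, distinctSum (fun z : Fin n → SpaceTime d =>
        ∏ i, w ((Fin.cons x z : Fin (n + 1) → SpaceTime d) i)) (φ.erase x) =
        w x * distinctSum (fun z : Fin n → SpaceTime d => ∏ i, w (z i)) (φ.erase x) := by
      intro x
      simp only [Fin.prod_univ_succ, Fin.cons_zero, Fin.cons_succ, distinctSum]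
      exact ENNReal.tsum_mul_left
    rw [distinctSum_succ, reducedSum]
    simp only [h2]
    rw [tsum_subtype φ.pts fun x => w x *
      distinctSum (fun z : Fin n → SpaceTime d => ∏ i, w (z i)) (φ.erase x),
      tsum_eq_sum (s := F)]
    · rw [Nat.factorial_succ, Nat.cast_mul, mul_comm ((n + 1 : ℕ) : ℝ≥0∞), mul_assoc]
      push_cast
      rw [← sum_mul_sum_powersetCard_erase, Finset.mul_sum]
      refine Finset.sum_congr rfl fun x hx => ?_
      rw [Set.indicator_of_mem (hF x hx), h1 x hx]
      ring
    · intro x hx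
      by_cases hφ : x ∈ φ.pts
      · rw [Set.indicator_of_mem hφ, hw x hφ hx, zero_mul]
      · rw [Set.indicator_of_notMem hφ]

/-- Expand the product and sort subsets by size; terms with `n` beyond `F.card` vanish, so the
series is finite. -/
theorem hasSum_sum_powersetCard {α : Type*} (w : α → ℝ) (F : Finset α) :
    HasSum (fun n : ℕ => (-1) ^ n * ∑ T ∈ F.powersetCard n, ∏ x ∈ T, w x) (∏ x ∈ F, (1 - w x)) := by
  classical
  have h : ∏ x ∈ F, (1 - w x) = ∑ n ∈ Finset.range (F.card + 1),
      (-1) ^ n * ∑ T ∈ F.powersetCard n, ∏ x ∈ T, w x := by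
    simp only [sub_eq_add_neg]
    rw [Finset.prod_one_add, Finset.sum_powerset]
    refine Finset.sum_congr rfl fun n _ => ?_
    rw [Finset.mul_sum]
    refine Finset.sum_congr rfl fun T hT => ?_
    rw [Finset.prod_neg, (Finset.mem_powersetCard.1 hT).2]
  rw [h]
  refine hasSum_sum_of_ne_finset_zero fun n hn => ?_
  rw [Finset.powersetCard_eq_empty.2 (by simpa [Nat.lt_succ_iff] using hn), Finset.sum_empty,
    mul_zero]

/-- The generating functional `E ∏ (1 - w (x))` is the alternating sum of the factorial moments of
`w`. -/
theorem exists_hasSum_factorialMoments (Q : Measure (Config d)) [IsProbabilityMeasure Q]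
    {w : SpaceTime d → ℝ} (hw : Measurable w) (hw0 : ∀ x, 0 ≤ w x) (hw1 : ∀ x, w x ≤ 1)
    {B : Set (SpaceTime d)} (hB : Bornology.IsBounded B) (hwB : ∀ x, x ∉ B → w x = 0) {M : ℝ}
    (hM : 0 ≤ M) (hQ : ∀ n : ℕ, ∫⁻ φ, distinctSum (fun z : Fin n → SpaceTime d =>
      ∏ i, ENNReal.ofReal (w (z i))) φ ∂Q ≤ ENNReal.ofReal (M ^ n)) :
    ∃ a ∈ Set.Icc (0 : ℝ) 1, HasSum (fun n : ℕ => (-1) ^ n / (n.factorial : ℝ) *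
      (∫⁻ φ, distinctSum (fun z : Fin n → SpaceTime d =>
        ∏ i, ENNReal.ofReal (w (z i))) φ ∂Q).toReal) a := by
  classical
  set D : ℕ → Config d → ℝ≥0∞ := fun n φ => distinctSum (fun z : Fin n → SpaceTime d =>
    ∏ i, ENNReal.ofReal (w (z i))) φ with hD
  have hDm : ∀ n, Measurable (D n) := fun n => measurable_distinctSum_const
    (Finset.measurable_fun_prod _ fun i _ => (hw.comp (measurable_pi_apply i)).ennreal_ofReal)
  have hDfin : ∀ n, ∫⁻ φ, D n φ ∂Q ≠ ∞ := fun n => ((hQ n).trans_lt ENNReal.ofReal_lt_top).ne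
  have hDint : ∀ n, ∫ φ, (D n φ).toReal ∂Q = (∫⁻ φ, D n φ ∂Q).toReal := fun n =>
    integral_toReal (hDm n).aemeasurable (ae_lt_top (hDm n) (hDfin n))
  set F : Config d → Finset (SpaceTime d) := fun φ => (φ.locFinite B hB).toFinset with hF
  have hsum : ∀ φ, HasSum (fun n : ℕ => (-1) ^ n / (n.factorial : ℝ) * (D n φ).toReal)
      (∏ x ∈ F φ, (1 - w x)) := by
    intro φ
    convert! hasSum_sum_powersetCard w (F φ) using 2 with n
    have h1 : D n φ = n.factorial * ∑ T ∈ (F φ).powersetCard n, ∏ x ∈ T, ENNReal.ofReal (w x) := by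
      refine distinctSum_prod (fun x => ENNReal.ofReal (w x)) n φ (F φ) (fun x hx => ?_)
        fun x hx hxF => ?_
      · exact ((φ.locFinite B hB).mem_toFinset.1 hx).1
      · rw [hwB x fun h => hxF ((φ.locFinite B hB).mem_toFinset.2 ⟨hx, h⟩), ENNReal.ofReal_zero]
    have h2 : ∑ T ∈ (F φ).powersetCard n, ∏ x ∈ T, ENNReal.ofReal (w x) =
        ENNReal.ofReal (∑ T ∈ (F φ).powersetCard n, ∏ x ∈ T, w x) := by
      rw [ENNReal.ofReal_sum_of_nonneg fun T _ => Finset.prod_nonneg fun x _ => hw0 x]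
      exact Finset.sum_congr rfl fun T _ =>
        (ENNReal.ofReal_prod_of_nonneg fun x _ => hw0 x).symm
    rw [h1, h2, ENNReal.toReal_mul, ENNReal.toReal_ofReal (Finset.sum_nonneg fun T _ =>
      Finset.prod_nonneg fun x _ => hw0 x), ENNReal.toReal_natCast]
    have := n.factorial_ne_zero
    field_simp
  have hint : ∀ n, Integrable (fun φ => (-1 : ℝ) ^ n / (n.factorial : ℝ) * (D n φ).toReal) Q :=
    fun n => (integrable_toReal_of_lintegral_ne_top (hDm n).aemeasurable (hDfin n)).const_mul _
  -- The moment bound `M ^ n` dominates the series by that of `exp M`, which justifies exchanging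
  -- sum and expectation.
  have hnorm : Summable fun n => ∫ φ, ‖(-1 : ℝ) ^ n / (n.factorial : ℝ) * (D n φ).toReal‖ ∂Q := by
    refine Summable.of_nonneg_of_le (fun n => integral_nonneg fun _ => norm_nonneg _) (fun n => ?_)
      (Real.summable_pow_div_factorial M)
    have h1 : ∀ φ, ‖(-1 : ℝ) ^ n / (n.factorial : ℝ) * (D n φ).toReal‖ =
        1 / (n.factorial : ℝ) * (D n φ).toReal := by
      intro φ
      rw [norm_mul, norm_div, norm_pow, norm_neg, norm_one, one_pow, Real.norm_natCast,
        Real.norm_of_nonneg ENNReal.toReal_nonneg]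
    simp only [h1]
    rw [integral_const_mul, hDint, one_div, div_eq_inv_mul]
    gcongr
    exact ENNReal.toReal_le_of_le_ofReal (pow_nonneg hM n) (hQ n)
  have hres := hasSum_integral_of_summable_integral_norm hint hnorm
  simp only [integral_const_mul, hDint, fun φ => (hsum φ).tsum_eq] at hres
  have hb : ∀ φ, ∏ x ∈ F φ, (1 - w x) ∈ Set.Icc (0 : ℝ) 1 := fun φ =>
    ⟨Finset.prod_nonneg fun x _ => sub_nonneg.2 (hw1 x), Finset.prod_le_one
      (fun x _ => sub_nonneg.2 (hw1 x)) fun x _ => sub_le_self _ (hw0 x)⟩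
  refine ⟨_, ⟨integral_nonneg fun φ => (hb φ).1, ?_⟩, hres⟩
  calc ∫ φ, ∏ x ∈ F φ, (1 - w x) ∂Q ≤ ∫ _, (1 : ℝ) ∂Q :=
        integral_mono_of_nonneg (.of_forall fun φ => (hb φ).1) (integrable_const _)
          (.of_forall fun φ => (hb φ).2)
    _ = 1 := by simp

/-! ### Sums over set partitions -/

section Partitions

variable {α γ R : Type*} [DecidableEq γ] [CommSemiring R]

theorem sum_powerset_map (g : Finset γ → R) (e : α ↪ γ) (s : Finset α) :
    ∑ T ∈ (s.map e).powerset, g T = ∑ T ∈ s.powerset, g (T.map e) := by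
  rw [Finset.map_eq_image, Finset.powerset_image, Finset.sum_image]
  · simp only [Finset.map_eq_image]
  · exact fun T _ T' _ h => Finset.image_injective e.injective h

variable [DecidableEq α]

/-- The sum over the partitions of `s` of the products of `f` over the blocks. -/
def partitionSum (f : Finset α → R) (s : Finset α) : R :=
  ∑ π : Finpartition s, ∏ D ∈ π.parts, f D

theorem partitionSum_empty (f : Finset α → R) : partitionSum f ∅ = 1 := by
  have h : ∀ π : Finpartition (∅ : Finset α), π.parts = ∅ := fun π =>
    Finpartition.parts_eq_empty_iff.2 rfl
  have hu : ∀ π π' : Finpartition (∅ : Finset α), π = π' := fun π π' =>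
    Finpartition.ext ((h π).trans (h π').symm)
  have hs := Finset.sum_eq_single_of_mem (s := Finset.univ)
    (f := fun π : Finpartition (∅ : Finset α) => ∏ D ∈ π.parts, f D)
    (Finpartition.empty (Finset α)) (Finset.mem_univ _) fun π _ hπ => absurd (hu _ _) hπ
  exact hs.trans (by rw [h, Finset.prod_empty])

/-- Expansion of a partition sum along the block that contains a given element. -/
theorem partitionSum_insert (f : Finset α → R) {a : α} {s : Finset α} (ha : a ∉ s) :
    partitionSum f (insert a s) =
      ∑ T ∈ s.powerset, f (insert a T) * partitionSum f (s \ T) := by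
  have hnot : ∀ {T : Finset α} (π : Finpartition (s \ T)) {D : Finset α}, D ∈ π.parts → a ∉ D :=
    fun π D hD h => ha (Finset.mem_sdiff.1 (π.le hD h)).1
  simp only [partitionSum, Finset.mul_sum]
  rw [Finset.sum_sigma']
  symm
  -- A partition of `insert a s` is determined by the block `insert a T` of `a` and a partition of
  -- the rest `s \ T`.
  refine Finset.sum_bij (fun q hq => q.2.extend (b := insert a q.1) (c := insert a s)
    (Finset.insert_nonempty _ _).ne_empty ?_ ?_) (fun _ _ => Finset.mem_univ _) ?_ ?_ ?_
  · rw [Finset.disjoint_insert_right]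
    exact ⟨fun h => ha (Finset.mem_sdiff.1 h).1, Finset.sdiff_disjoint⟩
  · have hT : q.1 ⊆ s := Finset.mem_powerset.1 (Finset.mem_sigma.1 hq).1
    ext x
    have := @hT x
    simp only [Finset.sup_eq_union, Finset.mem_union, Finset.mem_sdiff, Finset.mem_insert]
    tauto
  · rintro ⟨T, π⟩ hT ⟨T', π'⟩ hT' h
    have h1 : insert (insert a T) π.parts = insert (insert a T') π'.parts :=
      congrArg Finpartition.parts h
    have h2 : insert a T = insert a T' := by
      have h3 := h1 ▸ Finset.mem_insert_self (insert a T) π.parts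
      refine (Finset.mem_insert.1 h3).resolve_right fun h4 => ?_
      exact hnot π' h4 (Finset.mem_insert_self a T)
    have haT : a ∉ T := fun h => ha (Finset.mem_powerset.1 (Finset.mem_sigma.1 hT).1 h)
    have haT' : a ∉ T' := fun h => ha (Finset.mem_powerset.1 (Finset.mem_sigma.1 hT').1 h)
    obtain rfl : T = T' := by
      rw [← Finset.erase_insert haT, h2, Finset.erase_insert haT']
    have h5 : insert a T ∉ π.parts := fun h => hnot π h (Finset.mem_insert_self a T)
    have h6 : insert a T ∉ π'.parts := fun h => hnot π' h (Finset.mem_insert_self a T)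
    have h7 : π = π' := Finpartition.ext (by
      rw [← Finset.erase_insert h5, h1, Finset.erase_insert h6])
    rw [h7]
  · intro π _
    have has : a ∈ insert a s := Finset.mem_insert_self a s
    have hD := (π.part_mem).2 has
    have haD := (π.mem_part_self).2 has
    set D := π.part a
    have hDs : D.erase a ⊆ s := fun x hx => (Finset.mem_insert.1 (π.le hD
      (Finset.mem_of_mem_erase hx))).resolve_left (Finset.ne_of_mem_erase hx)
    refine ⟨⟨D.erase a, π.ofSubset (Finset.erase_subset D π.parts) ?_⟩, ?_, ?_⟩
    · ext x
      simp only [Finset.mem_sup, Finset.mem_erase, id, Finset.mem_sdiff, not_and]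
      constructor
      · rintro ⟨E, ⟨hED, hE⟩, hx⟩
        have hxD : x ∉ D := fun h => hED (π.eq_of_mem_parts hE hD hx h)
        refine ⟨(Finset.mem_insert.1 (π.le hE hx)).resolve_left ?_, fun _ => hxD⟩
        rintro rfl
        exact hxD haD
      · rintro ⟨hxs, hx⟩
        obtain ⟨E, hE, hxE⟩ := π.exists_mem (Finset.mem_insert_of_mem hxs)
        refine ⟨E, ⟨?_, hE⟩, hxE⟩
        rintro rfl
        refine hx ?_ hxE
        rintro rfl
        exact ha hxs
    · simp [hDs]
    · refine Finpartition.ext ?_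
      simp [Finset.insert_erase haD, Finset.insert_erase hD]
  · rintro ⟨T, π⟩ _
    rw [Finpartition.extend_parts, Finset.prod_insert]
    exact fun h => hnot π h (Finset.mem_insert_self a T)

/-- Induction through `partitionSum_insert` avoids transporting partitions along `e`. -/
theorem partitionSum_map (f : Finset γ → R) (e : α ↪ γ) (s : Finset α) :
    partitionSum f (s.map e) = partitionSum (fun D => f (D.map e)) s := by
  induction s using Finset.strongInduction with
  | _ s ih =>
    obtain rfl | ⟨a, ha⟩ := s.eq_empty_or_nonempty
    · simp [partitionSum_empty]
    · obtain ⟨s, has, rfl⟩ : ∃ s', a ∉ s' ∧ insert a s' = s :=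
        ⟨s.erase a, Finset.notMem_erase a s, Finset.insert_erase ha⟩
      have has' : e a ∉ s.map e := by simpa using has
      rw [Finset.map_insert, partitionSum_insert _ has', partitionSum_insert _ has,
        sum_powerset_map]
      refine Finset.sum_congr rfl fun T _ => ?_
      rw [Finset.map_insert, ← Finset.map_sdiff, ih (s \ T)]
      exact Finset.sdiff_subset.trans_ssubset (Finset.ssubset_insert has)

end Partitions

/-! ### Normalised product densities and correlation functions -/

section Correlation

variable (ρ : ∀ n : ℕ, (Fin n → SpaceTime d) → ℝ)

/-- `ξ_{|D|} (z_i : i ∈ D)`. -/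
noncomputable def corrOn {n : ℕ} (z : Fin n → SpaceTime d) (D : Finset (Fin n)) : ℝ :=
  corr ρ D.card fun i => z (D.orderEmbOfFin rfl i)

/-- The product density normalised by the intensities, with the value `1` for `n = 0`. -/
noncomputable def normDensity (n : ℕ) (z : Fin n → SpaceTime d) : ℝ :=
  partitionSum (corrOn ρ z) Finset.univ

theorem normDensity_zero (z : Fin 0 → SpaceTime d) : normDensity ρ 0 z = 1 :=
  partitionSum_empty _

theorem normDensity_eq_div {n : ℕ} (hn : 1 ≤ n) (z : Fin n → SpaceTime d) :
    normDensity ρ n z = ρ n z / ∏ k, ρ 1 (fun _ => z k) :=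
  (corr_relation ρ hn z).symm

/-- The increasing enumeration of a finite set is unique. -/
theorem corrOn_eq {n k : ℕ} (z : Fin n → SpaceTime d) {g : Fin k → Fin n} (hg : StrictMono g)
    {D : Finset (Fin n)} (hD : D.card = k) (hgD : ∀ i, g i ∈ D) :
    corrOn ρ z D = corr ρ k fun i => z (g i) := by
  subst hD
  rw [corrOn, Finset.orderEmbOfFin_unique rfl hgD hg]

theorem normDensity_comp {n : ℕ} (z : Fin n → SpaceTime d) (D : Finset (Fin n)) :
    normDensity ρ D.card (fun i => z (D.orderEmbOfFin rfl i)) = partitionSum (corrOn ρ z) D := by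
  conv_rhs => rw [← Finset.map_orderEmbOfFin_univ D rfl, partitionSum_map]
  rw [normDensity]
  congr 1
  funext E
  symm
  refine corrOn_eq ρ z (g := fun i => D.orderEmbOfFin rfl (E.orderEmbOfFin rfl i)) ?_ (by simp) ?_
  · exact (D.orderEmbOfFin rfl).strictMono.comp (E.orderEmbOfFin rfl).strictMono
  · intro i
    exact Finset.mem_map_of_mem _ (Finset.orderEmbOfFin_mem E rfl i)

/-- Expansion of the normalised density along the block that contains the first point. -/
theorem normDensity_cons {n : ℕ} (x : SpaceTime d) (z : Fin n → SpaceTime d) :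
    normDensity ρ (n + 1) (Fin.cons x z) = ∑ T : Finset (Fin n),
      corr ρ (T.card + 1) (Fin.cons x fun i => z (T.orderEmbOfFin rfl i)) *
        normDensity ρ Tᶜ.card (fun i => z (Tᶜ.orderEmbOfFin rfl i)) := by
  set w : Fin (n + 1) → SpaceTime d := Fin.cons x z with hw
  have h0 : (0 : Fin (n + 1)) ∉ Finset.univ.map (Fin.succEmb n) := by simp
  have hu : (Finset.univ : Finset (Fin (n + 1))) = insert 0 (Finset.univ.map (Fin.succEmb n)) := by
    ext i
    refine Fin.cases ?_ (fun i => ?_) i <;> simp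
  rw [normDensity, hu, partitionSum_insert _ h0, sum_powerset_map, Finset.powerset_univ]
  refine Finset.sum_congr rfl fun T _ => ?_
  congr 1
  · have h0T : (0 : Fin (n + 1)) ∉ T.map (Fin.succEmb n) := by simp
    rw [corrOn_eq ρ w (g := (Fin.cons 0 fun i => (T.orderEmbOfFin rfl i).succ :
      Fin (T.card + 1) → Fin (n + 1))) ?_
      (by rw [Finset.card_insert_of_notMem h0T, Finset.card_map])]
    · congr 1
      funext i
      refine Fin.cases ?_ (fun i => ?_) i <;> simp [hw]
    · refine Fin.cases ?_ fun i => ?_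
      · simp
      · simp only [Fin.cons_succ]
        exact Finset.mem_insert_of_mem (Finset.mem_map_of_mem _ (Finset.orderEmbOfFin_mem T rfl i))
    · intro i j
      refine Fin.cases ?_ (fun i => ?_) i <;> refine Fin.cases ?_ (fun j => ?_) j <;> simp
  · rw [normDensity_comp, ← Finset.map_sdiff, ← Finset.compl_eq_univ_sdiff, partitionSum_map]
    congr 1
    funext E
    rw [corrOn_eq ρ w (g := fun i => (E.orderEmbOfFin rfl i).succ) ?_ (by simp)]
    · simp [corrOn, hw]
    · exact fun i => Finset.mem_map_of_mem _ (Finset.orderEmbOfFin_mem E rfl i)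
    · exact fun i j hij => Fin.succ_lt_succ_iff.2 ((E.orderEmbOfFin rfl).strictMono hij)

/-- Blocks of a partition are nonempty, so invariance for `1 ≤ n` covers every factor. -/
theorem normDensity_add (hinv : ∀ n, 1 ≤ n → ∀ (a : SpaceTime d) (z : Fin n → SpaceTime d),
    corr ρ n (fun i => z i + a) = corr ρ n z) {n : ℕ} (a : SpaceTime d)
    (z : Fin n → SpaceTime d) : normDensity ρ n (fun i => z i + a) = normDensity ρ n z := by
  rw [normDensity, normDensity, partitionSum, partitionSum]
  refine Finset.sum_congr rfl fun π _ => Finset.prod_congr rfl fun D hD => ?_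
  exact hinv _ (Finset.card_pos.2 (π.nonempty_of_mem_parts hD)) a _

end Correlation

/-! ### Integration over powers of the cylinder -/

section Integrals

variable {E : Type*} [MeasurableSpace E] (μ : Measure E) [SigmaFinite μ]

theorem measurePreserving_split {n : ℕ} (T : Finset (Fin n)) :
    MeasurePreserving (fun z : Fin n → E =>
      ((fun i => z (T.orderEmbOfFin rfl i) : Fin T.card → E),
        (fun i => z (Tᶜ.orderEmbOfFin rfl i) : Fin Tᶜ.card → E)))
      (Measure.pi fun _ => μ) ((Measure.pi fun _ => μ).prod (Measure.pi fun _ => μ)) := by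
  have h1 := (measurePreserving_piCongrLeft (fun _ : Fin n => μ)
    (finSumEquivOfFinset (s := T) rfl rfl)).symm
  have h2 := measurePreserving_sumPiEquivProdPi (fun _ : Fin T.card ⊕ Fin Tᶜ.card => μ)
  convert! h2.comp h1 using 1

end Integrals

/-- Coordinates relative to the first point. They turn an almost everywhere statement about all
tuples into one about tuples seen from a single base point. -/
theorem measurePreserving_cons_add (d n : ℕ) :
    MeasurePreserving (fun q : SpaceTime d × (Fin n → SpaceTime d) =>
      (Fin.cons q.1 fun i => q.2 i + q.1 : Fin (n + 1) → SpaceTime d)) volume volume := by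
  have h1 : MeasurePreserving (fun q : SpaceTime d × (Fin n → SpaceTime d) =>
      (id q.1, q.2 + fun _ => q.1)) (volume.prod volume) (volume.prod volume) := by
    refine MeasurePreserving.skew_product
      (g := fun (x : SpaceTime d) (z : Fin n → SpaceTime d) => z + fun _ => x)
      (MeasurePreserving.id _) ?_ (.of_forall fun x => ?_)
    · exact measurable_snd.add (measurable_pi_iff.2 fun _ => measurable_fst)
    · exact (measurePreserving_pi (fun _ => volume) (fun _ => volume)
        (f := fun _ : Fin n => fun y : SpaceTime d => y + x)
        fun _ => (measurePreserving_add_right volume x.1).prod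
          (measurePreserving_add_right volume x.2)).map_eq
  exact (measurePreserving_cons (SpaceTime d) volume n).comp h1

/-- The uniform measure on the cylinder to the power `n`. -/
noncomputable def cylMeasure (d : ℕ) (r t : ℝ) (n : ℕ) : Measure (Fin n → SpaceTime d) :=
  Measure.pi fun _ => volume.restrict (cyl d r t)

instance isFiniteMeasure_restrict_cyl (d : ℕ) (r t : ℝ) :
    IsFiniteMeasure (volume.restrict (cyl d r t)) :=
  ⟨by simpa using (isBounded_cyl d r t).measure_lt_top⟩

instance isFiniteMeasure_cylMeasure (d : ℕ) (r t : ℝ) (n : ℕ) :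
    IsFiniteMeasure (cylMeasure d r t n) := by
  unfold cylMeasure
  infer_instance

theorem cylMeasure_eq_restrict (d : ℕ) (r t : ℝ) (n : ℕ) :
    cylMeasure d r t n = volume.restrict (Set.pi Set.univ fun _ => cyl d r t) :=
  (Measure.restrict_pi_pi _ _).symm

theorem cylMeasure_zero (d : ℕ) (r t : ℝ) : IsProbabilityMeasure (cylMeasure d r t 0) := by
  unfold cylMeasure
  rw [Measure.pi_of_empty _ Fin.elim0]
  infer_instance

theorem JCoeff_eq (ρ : ∀ n : ℕ, (Fin n → SpaceTime d) → ℝ) (n : ℕ) (r t : ℝ) :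
    JCoeff ρ n r t = ∫ z, corr ρ (n + 1) (Fin.cons 0 z) ∂(cylMeasure d r t n) := by
  have : {z : Fin n → SpaceTime d | ∀ i, z i ∈ cyl d r t} =
      Set.pi Set.univ fun _ => cyl d r t := by
    ext z
    simp
  rw [JCoeff, cylMeasure_eq_restrict, this]

/-! ### The inhomogeneous J-function of the thinning -/

namespace IsIRMS

variable {Q : Measure (Config d)} {ρ : ∀ n : ℕ, (Fin n → SpaceTime d) → ℝ}

theorem infIntensity_le (h : IsIRMS Q ρ) (x : SpaceTime d) : infIntensity ρ ≤ ρ 1 fun _ => x :=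
  ciInf_le ⟨0, by rintro _ ⟨y, rfl⟩; exact (h.density 1 le_rfl).nonneg _⟩ x

theorem intensity_pos (h : IsIRMS Q ρ) (x : SpaceTime d) : 0 < ρ 1 fun _ => x :=
  h.inf_pos.trans_le (h.infIntensity_le x)

theorem measurable_intensity (h : IsIRMS Q ρ) : Measurable fun x : SpaceTime d => ρ 1 fun _ => x :=
  (h.density 1 le_rfl).measurable.comp (measurable_pi_iff.2 fun _ => measurable_id)

theorem measurable_normDensity (h : IsIRMS Q ρ) (n : ℕ) : Measurable (normDensity ρ n) := by
  obtain rfl | hn := Nat.eq_zero_or_pos n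
  · simp only [funext (normDensity_zero ρ), measurable_const]
  · rw [funext (normDensity_eq_div ρ hn)]
    exact (h.density n hn).measurable.div (Finset.measurable_fun_prod _ fun i _ =>
      h.measurable_intensity.comp (measurable_pi_apply i))

theorem normDensity_nonneg (h : IsIRMS Q ρ) {n : ℕ} (z : Fin n → SpaceTime d) :
    0 ≤ normDensity ρ n z := by
  obtain rfl | hn := Nat.eq_zero_or_pos n
  · rw [normDensity_zero]
    exact zero_le_one
  · rw [normDensity_eq_div ρ hn]
    exact div_nonneg ((h.density n hn).nonneg _)
      (Finset.prod_nonneg fun i _ => (h.intensity_pos _).le)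

theorem normDensity_one (h : IsIRMS Q ρ) (z : Fin 1 → SpaceTime d) : normDensity ρ 1 z = 1 := by
  have hz : z = fun _ => z 0 := by
    funext i
    rw [Subsingleton.elim i 0]
  rw [normDensity_eq_div ρ le_rfl, Fin.prod_univ_one, ← hz]
  refine div_self ?_
  rw [hz]
  exact (h.intensity_pos (z 0)).ne'

/-- The weight `lam_inf / lam (x)` on the cylinder. -/
noncomputable def weight (ρ : ∀ n : ℕ, (Fin n → SpaceTime d) → ℝ) (r t : ℝ) (x : SpaceTime d) : ℝ :=
  (cyl d r t).indicator (fun x => infIntensity ρ / ρ 1 fun _ => x) x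

theorem measurable_weight (h : IsIRMS Q ρ) (r t : ℝ) : Measurable (weight ρ r t) :=
  (measurable_const.div h.measurable_intensity).indicator (measurableSet_cyl d r t)

theorem weight_nonneg (h : IsIRMS Q ρ) (r t : ℝ) (x : SpaceTime d) : 0 ≤ weight ρ r t x :=
  Set.indicator_nonneg (fun x _ => div_nonneg h.inf_pos.le (h.intensity_pos x).le) x

theorem weight_le_one (h : IsIRMS Q ρ) (r t : ℝ) (x : SpaceTime d) : weight ρ r t x ≤ 1 :=
  Set.indicator_le' (g := fun _ => 1)
    (fun x _ => (div_le_one (h.intensity_pos x)).2 (h.infIntensity_le x)) (fun _ _ => zero_le_one) x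

theorem measurable_prod_weight (h : IsIRMS Q ρ) (r t : ℝ) (n : ℕ) :
    Measurable fun z : Fin n → SpaceTime d => ∏ i, ENNReal.ofReal (weight ρ r t (z i)) :=
  Finset.measurable_fun_prod _ fun i _ =>
    ((h.measurable_weight r t).comp (measurable_pi_apply i)).ennreal_ofReal

/-- In the Campbell formula the denominators of the weights are exactly the intensities by which `ρ
n` is normalised. For `n = 0` both sides are 1. -/
theorem lintegral_distinctSum_weight [IsProbabilityMeasure Q] (h : IsIRMS Q ρ) (r t : ℝ) (n : ℕ) :
    ∫⁻ φ, distinctSum (fun z : Fin n → SpaceTime d =>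
      ∏ i, ENNReal.ofReal (weight ρ r t (z i))) φ ∂Q =
    ∫⁻ z, ENNReal.ofReal (infIntensity ρ ^ n * normDensity ρ n z) ∂(cylMeasure d r t n) := by
  obtain rfl | hn := Nat.eq_zero_or_pos n
  · have := cylMeasure_zero d r t
    simp [distinctSum_zero, normDensity_zero]
  rw [(h.density n hn).campbell _ (h.measurable_prod_weight r t n), cylMeasure_eq_restrict,
    ← lintegral_indicator (MeasurableSet.univ_pi fun _ => measurableSet_cyl d r t)]
  refine lintegral_congr fun z => ?_
  by_cases hz : z ∈ Set.pi Set.univ fun _ => cyl d r t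
  · rw [Set.indicator_of_mem hz,
      ← ENNReal.ofReal_prod_of_nonneg fun i _ => h.weight_nonneg r t (z i),
      ← ENNReal.ofReal_mul (Finset.prod_nonneg fun i _ => h.weight_nonneg r t (z i)),
      normDensity_eq_div ρ hn]
    congr 1
    have : ∀ i, weight ρ r t (z i) = infIntensity ρ / ρ 1 fun _ => z i := fun i =>
      Set.indicator_of_mem (hz i trivial) _
    simp only [this, Finset.prod_div_distrib, Finset.prod_const, Finset.card_univ,
      Fintype.card_fin]
    ring
  · rw [Set.indicator_of_notMem hz]
    simp only [Set.mem_pi, Set.mem_univ, true_imp_iff, not_forall] at hz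
    obtain ⟨i, hi⟩ := hz
    rw [Finset.prod_eq_zero (Finset.mem_univ i), zero_mul]
    rw [weight, Set.indicator_of_notMem hi, ENNReal.ofReal_zero]

variable {β RS RT r t : ℝ} {P : Measure (Config d)} {p : SpaceTime d → unitInterval}

theorem lintegral_distinctSum_weight_le [IsProbabilityMeasure P]
    (h : IsIRMS Q ρ) (hβ : 0 < β) (hP : IsHardCore β RS RT P) (hQ : IsThinning p P Q) (n : ℕ) :
    ∫⁻ φ, distinctSum (fun z : Fin n → SpaceTime d =>
      ∏ i, ENNReal.ofReal (weight ρ r t (z i))) φ ∂Q ≤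
    ENNReal.ofReal ((β * volume.real (cyl d r t)) ^ n) := by
  have hm := h.measurable_prod_weight r t n
  refine (hQ.lintegral_distinctSum_le hm).trans ((hP.lintegral_distinctSum_le hm).trans ?_)
  rw [ENNReal.ofReal_pow (by positivity), ENNReal.ofReal_mul hβ.le, mul_pow]
  gcongr
  have hc : ENNReal.ofReal (volume.real (cyl d r t)) = volume (cyl d r t) :=
    ENNReal.ofReal_toReal (isBounded_cyl d r t).measure_lt_top.ne
  calc ∫⁻ z : Fin n → SpaceTime d, ∏ i, ENNReal.ofReal (weight ρ r t (z i))
      ≤ ∫⁻ z, (Set.pi Set.univ fun _ => cyl d r t).indicator 1 z := by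
        refine lintegral_mono fun z => ?_
        by_cases hz : z ∈ Set.pi Set.univ fun _ => cyl d r t
        · rw [Set.indicator_of_mem hz]
          refine Finset.prod_le_one' fun i _ => ?_
          exact ENNReal.ofReal_le_one.2 (h.weight_le_one r t _)
        · simp only [Set.mem_pi, Set.mem_univ, true_imp_iff, not_forall] at hz
          obtain ⟨i, hi⟩ := hz
          rw [Finset.prod_eq_zero (Finset.mem_univ i)]
          · exact bot_le
          · rw [weight, Set.indicator_of_notMem hi, ENNReal.ofReal_zero]
    _ = ENNReal.ofReal (volume.real (cyl d r t)) ^ n := by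
        rw [lintegral_indicator_one (MeasurableSet.univ_pi fun _ => measurableSet_cyl d r t),
          volume_pi_pi, hc]
        simp

theorem integrable_normDensity [IsProbabilityMeasure P] [IsProbabilityMeasure Q]
    (h : IsIRMS Q ρ) (hβ : 0 < β) (hP : IsHardCore β RS RT P) (hQ : IsThinning p P Q) (n : ℕ) :
    Integrable (normDensity ρ n) (cylMeasure d r t n) := by
  have h1 : Integrable (fun z => infIntensity ρ ^ n * normDensity ρ n z) (cylMeasure d r t n) := by
    refine ⟨((h.measurable_normDensity n).const_mul _).aestronglyMeasurable, ?_⟩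
    rw [hasFiniteIntegral_iff_ofReal
      (.of_forall fun z => mul_nonneg (pow_nonneg h.inf_pos.le n) (h.normDensity_nonneg z)),
      ← h.lintegral_distinctSum_weight]
    exact (h.lintegral_distinctSum_weight_le hβ hP hQ n).trans_lt ENNReal.ofReal_lt_top
  exact (integrable_const_mul_iff (pow_pos h.inf_pos n).ne'.isUnit _).1 h1

theorem toReal_lintegral_distinctSum_weight [IsProbabilityMeasure Q] (h : IsIRMS Q ρ)
    (r t : ℝ) (n : ℕ) :
    (∫⁻ φ, distinctSum (fun z : Fin n → SpaceTime d =>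
      ∏ i, ENNReal.ofReal (weight ρ r t (z i))) φ ∂Q).toReal =
    infIntensity ρ ^ n * ∫ z, normDensity ρ n z ∂(cylMeasure d r t n) := by
  rw [h.lintegral_distinctSum_weight, ← integral_const_mul, integral_eq_lintegral_of_nonneg_ae
    (.of_forall fun z => mul_nonneg (pow_nonneg h.inf_pos.le n) (h.normDensity_nonneg z))
    ((h.measurable_normDensity n).const_mul _).aestronglyMeasurable]

/-- The density of pairs at a distance within the hard core vanishes. -/
theorem normDensity_cons_ae_eq_zero (h : IsIRMS Q ρ) (hP : IsHardCore β RS RT P)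
    (hQ : IsThinning p P Q) (hr : r ≤ RS) (ht : t ≤ RT) (n : ℕ) :
    (fun z => normDensity ρ (n + 2) (Fin.cons 0 z)) =ᵐ[cylMeasure d r t (n + 1)] 0 := by
  set A : Set (Fin (n + 2) → SpaceTime d) := {z | z 1 - z 0 ∈ cyl d RS RT} with hA
  have hAm : MeasurableSet A := (measurableSet_cyl d RS RT).preimage
    ((measurable_pi_apply 1).sub (measurable_pi_apply 0))
  have hd := h.density (n + 2) (by omega)
  have hm : Measurable (A.indicator (1 : (Fin (n + 2) → SpaceTime d) → ℝ≥0∞)) :=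
    measurable_one.indicator hAm
  have h1 : ∫⁻ z, A.indicator 1 z * ENNReal.ofReal (ρ (n + 2) z) = 0 := by
    rw [← hd.campbell _ hm]
    refine le_antisymm ((hQ.lintegral_distinctSum_le hm).trans (le_of_eq ?_)) bot_le
    exact hP.lintegral_distinctSum_eq_zero hm fun z hz =>
      Set.indicator_of_notMem (fun hzA : z ∈ A => hz hzA) _
  replace h1 := (lintegral_eq_zero_iff (hm.mul hd.measurable.ennreal_ofReal)).1 h1
  have h2 : ∀ᵐ z, z ∈ A → normDensity ρ (n + 2) z = 0 := by
    filter_upwards [h1] with z hz hzA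
    rw [Pi.mul_apply, Set.indicator_of_mem hzA, Pi.one_apply, one_mul, Pi.zero_apply,
      ENNReal.ofReal_eq_zero] at hz
    rw [normDensity_eq_div ρ (by omega), le_antisymm hz (hd.nonneg z), zero_div]
  -- Tuples based at the origin form a null set, so `h2` says nothing about them directly. Fubini
  -- supplies some base point `x` that is good for almost all relative positions, and translation
  -- invariance moves it to the origin.
  have h3 := (measurePreserving_cons_add d (n + 1)).quasiMeasurePreserving.ae h2
  obtain ⟨x, hx⟩ := (Measure.ae_ae_of_ae_prod h3).exists
  rw [cylMeasure_eq_restrict]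
  filter_upwards [ae_restrict_of_ae hx,
    ae_restrict_mem (MeasurableSet.univ_pi fun _ => measurableSet_cyl d r t)] with z hz hzS
  have h4 : (Fin.cons x fun i => z i + x : Fin (n + 2) → SpaceTime d) =
      fun i => (Fin.cons 0 z : Fin (n + 2) → SpaceTime d) i + x := by
    funext i
    refine Fin.cases ?_ (fun i => ?_) i <;> simp
  refine (normDensity_add ρ h.invariant x _).symm.trans ?_
  rw [← h4]
  refine hz ?_
  have h5 : (Fin.cons x fun i => z i + x : Fin (n + 2) → SpaceTime d) 1 -
      (Fin.cons x fun i => z i + x : Fin (n + 2) → SpaceTime d) 0 = z 0 := by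
    rw [← Fin.succ_zero_eq_one, Fin.cons_succ, Fin.cons_zero, add_sub_cancel_right]
  change _ ∈ cyl d RS RT
  rw [h5]
  exact cyl_mono hr ht (hzS 0 trivial)

theorem integrable_normDensity_cons (h : IsIRMS Q ρ) (hP : IsHardCore β RS RT P)
    (hQ : IsThinning p P Q) (hr : r ≤ RS) (ht : t ≤ RT) (n : ℕ) :
    Integrable (fun z => normDensity ρ (n + 1) (Fin.cons 0 z)) (cylMeasure d r t n) := by
  cases n with
  | zero =>
    simp only [h.normDensity_one]
    exact integrable_const _
  | succ n =>
    exact (integrable_zero _ _ _).congr (h.normDensity_cons_ae_eq_zero hP hQ hr ht n).symm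

theorem integral_normDensity_cons (h : IsIRMS Q ρ) (hP : IsHardCore β RS RT P)
    (hQ : IsThinning p P Q) (hr : r ≤ RS) (ht : t ≤ RT) (n : ℕ) :
    ∫ z, normDensity ρ (n + 1) (Fin.cons 0 z) ∂(cylMeasure d r t n) = if n = 0 then 1 else 0 := by
  cases n with
  | zero =>
    have := cylMeasure_zero d r t
    simp [h.normDensity_one]
  | succ n =>
    rw [integral_congr_ae (h.normDensity_cons_ae_eq_zero hP hQ hr ht n)]
    simp

theorem integrable_split {n : ℕ} (T : Finset (Fin n)) {f : (Fin T.card → SpaceTime d) → ℝ}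
    {g : (Fin Tᶜ.card → SpaceTime d) → ℝ} (hf : Integrable f (cylMeasure d r t T.card))
    (hg : Integrable g (cylMeasure d r t Tᶜ.card)) :
    Integrable (fun z : Fin n → SpaceTime d => f (fun i => z (T.orderEmbOfFin rfl i)) *
      g (fun i => z (Tᶜ.orderEmbOfFin rfl i))) (cylMeasure d r t n) :=
  (measurePreserving_split (volume.restrict (cyl d r t)) T).integrable_comp_of_integrable
    (hf.mul_prod hg)

theorem integral_split {n : ℕ} (T : Finset (Fin n)) {f : (Fin T.card → SpaceTime d) → ℝ}
    {g : (Fin Tᶜ.card → SpaceTime d) → ℝ} (hf : Integrable f (cylMeasure d r t T.card))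
    (hg : Integrable g (cylMeasure d r t Tᶜ.card)) :
    ∫ z : Fin n → SpaceTime d, f (fun i => z (T.orderEmbOfFin rfl i)) *
      g (fun i => z (Tᶜ.orderEmbOfFin rfl i)) ∂(cylMeasure d r t n) =
    (∫ z, f z ∂(cylMeasure d r t T.card)) * ∫ z, g z ∂(cylMeasure d r t Tᶜ.card) := by
  have h := measurePreserving_split (volume.restrict (cyl d r t)) T
  have h1 := integral_map h.measurable.aemeasurable
    (f := fun q : (Fin T.card → SpaceTime d) × (Fin Tᶜ.card → SpaceTime d) => f q.1 * g q.2)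
    (by rw [h.map_eq]; exact (hf.mul_prod hg).aestronglyMeasurable)
  rw [h.map_eq] at h1
  exact h1.symm.trans (integral_prod_mul f g)

theorem corr_cons_comp {n k : ℕ} (hk : k = n) (x : SpaceTime d) (z : Fin n → SpaceTime d)
    {e : Fin k → Fin n} (he : StrictMono e) :
    corr ρ (k + 1) (Fin.cons x fun i => z (e i)) = corr ρ (n + 1) (Fin.cons x z) := by
  subst hk
  obtain rfl : e = id := by
    refine (Finset.orderEmbOfFin_unique (s := Finset.univ) (by simp) (by simp) he).trans ?_
    exact (Finset.orderEmbOfFin_unique (s := Finset.univ) (by simp) (by simp) strictMono_id).symm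
  rfl

/-- Strong induction: in `normDensity_cons` the term `T = univ` is the wanted correlation function,
and all others involve correlation functions of fewer points. -/
theorem integrable_corr [IsProbabilityMeasure P] [IsProbabilityMeasure Q]
    (h : IsIRMS Q ρ) (hβ : 0 < β) (hP : IsHardCore β RS RT P) (hQ : IsThinning p P Q)
    (hr : r ≤ RS) (ht : t ≤ RT) (n : ℕ) :
    Integrable (fun z => corr ρ (n + 1) (Fin.cons 0 z)) (cylMeasure d r t n) := by
  induction n using Nat.strong_induction_on with
  | _ n ih =>
    have h1 : ∀ z : Fin n → SpaceTime d, corr ρ (n + 1) (Fin.cons 0 z) =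
        normDensity ρ (n + 1) (Fin.cons 0 z) -
          ∑ T ∈ (Finset.univ : Finset (Finset (Fin n))).erase Finset.univ,
            corr ρ (T.card + 1) (Fin.cons 0 fun i => z (T.orderEmbOfFin rfl i)) *
              normDensity ρ Tᶜ.card (fun i => z (Tᶜ.orderEmbOfFin rfl i)) := by
      intro z
      rw [normDensity_cons, ← Finset.add_sum_erase _ _ (Finset.mem_univ Finset.univ),
        add_sub_cancel_right, corr_cons_comp (by simp) _ _
          (Finset.orderEmbOfFin _ _).strictMono, normDensity_comp, Finset.compl_univ,
        partitionSum_empty, mul_one]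
    simp only [h1]
    refine (h.integrable_normDensity_cons hP hQ hr ht n).sub
      (integrable_finsetSum _ fun T hT => integrable_split T
        (f := fun z => corr ρ (T.card + 1) (Fin.cons 0 z)) (g := normDensity ρ Tᶜ.card) ?_ ?_)
    · refine ih _ ?_
      have := Finset.card_lt_card (Finset.ssubset_univ_iff.2 (Finset.ne_of_mem_erase hT))
      rwa [Finset.card_univ, Fintype.card_fin] at this
    · exact h.integrable_normDensity hβ hP hQ _

/-- Integrate `normDensity_cons`. Fubini factors each term, the factors depend only on the size of
`T`, and the left side of the expansion integrates to zero for `n ≥ 1` because of the hard core. -/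
theorem sum_choose_mul_JCoeff [IsProbabilityMeasure P] [IsProbabilityMeasure Q]
    (h : IsIRMS Q ρ) (hβ : 0 < β) (hP : IsHardCore β RS RT P) (hQ : IsThinning p P Q)
    (hr : r ≤ RS) (ht : t ≤ RT) (n : ℕ) :
    ∑ k ∈ Finset.range (n + 1), (n.choose k : ℝ) *
      (JCoeff ρ k r t * ∫ z, normDensity ρ (n - k) z ∂(cylMeasure d r t (n - k))) =
    if n = 0 then 1 else 0 := by
  have h1 := h.integrable_corr hβ hP hQ hr ht
  have h2 := h.integrable_normDensity (r := r) (t := t) hβ hP hQ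
  have h3 := Finset.sum_powerset_apply_card (fun k => JCoeff ρ k r t *
    ∫ z, normDensity ρ (n - k) z ∂(cylMeasure d r t (n - k))) (x := (Finset.univ : Finset (Fin n)))
  rw [Finset.card_univ, Fintype.card_fin, Finset.powerset_univ] at h3
  simp only [nsmul_eq_mul] at h3
  rw [← h3, ← h.integral_normDensity_cons hP hQ hr ht n]
  simp only [normDensity_cons]
  rw [integral_finsetSum _ fun T _ => integrable_split T
    (f := fun z => corr ρ (T.card + 1) (Fin.cons 0 z)) (g := normDensity ρ Tᶜ.card) (h1 _) (h2 _)]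
  refine Finset.sum_congr rfl fun T _ => ?_
  rw [integral_split T (f := fun z => corr ρ (T.card + 1) (Fin.cons 0 z))
    (g := normDensity ρ Tᶜ.card) (h1 _) (h2 _), ← JCoeff_eq]
  have : Tᶜ.card = n - T.card := by rw [Finset.card_compl, Fintype.card_fin]
  rw [this]

theorem one_le_JInhom [IsProbabilityMeasure P] [IsProbabilityMeasure Q]
    (h : IsIRMS Q ρ) (hβ : 0 < β) (hP : IsHardCore β RS RT P) (hQ : IsThinning p P Q)
    (hr : r ≤ RS) (ht : t ≤ RT) (hJ : JInhomDefined ρ r t) : 1 ≤ JInhom ρ r t := by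
  set a : ℕ → ℝ := fun n => ∫ z, normDensity ρ n z ∂(cylMeasure d r t n) with ha
  set lb := infIntensity ρ with hlb
  obtain ⟨A, ⟨hA0, hA1⟩, hA⟩ := exists_hasSum_factorialMoments Q (h.measurable_weight r t)
    (h.weight_nonneg r t) (h.weight_le_one r t) (isBounded_cyl d r t)
    (fun x hx => Set.indicator_of_notMem hx _)
    (M := β * volume.real (cyl d r t)) (by positivity)
    (h.lintegral_distinctSum_weight_le hβ hP hQ)
  simp only [h.toReal_lintegral_distinctSum_weight] at hA
  change HasSum (fun n : ℕ => (-1) ^ n / (n.factorial : ℝ) * (lb ^ n * a n)) A at hA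
  have hrec := h.sum_choose_mul_JCoeff hβ hP hQ hr ht
  have ha0 : a 0 = 1 := by
    have := cylMeasure_zero d r t
    simp [ha, normDensity_zero]
  have hJ0 : JTerm ρ r t 0 = 1 := by
    have h0 := hrec 0
    simp only [zero_add, Finset.sum_range_one, Nat.choose_self, Nat.cast_one, one_mul,
      Nat.sub_zero, if_true] at h0
    rw [show (∫ z, normDensity ρ 0 z ∂(cylMeasure d r t 0)) = 1 from ha0, mul_one] at h0
    simp [JTerm, h0]
  have hJs : Summable fun n => ‖JTerm ρ r t n‖ :=
    (summable_nat_add_iff 1).1 hJ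
  have hJsum : JInhom ρ r t = ∑' n, JTerm ρ r t n := by
    rw [JInhom, hJs.of_norm.tsum_eq_zero_add, hJ0]
  -- The Cauchy product of the two exponential generating series turns the binomial convolution into
  -- a product; only its constant term survives.
  have hprod := tsum_mul_tsum_eq_tsum_sum_antidiagonal_of_summable_norm hJs hA.summable.norm
  have hcoef : ∀ n, ∑ kl ∈ Finset.HasAntidiagonal.antidiagonal n, JTerm ρ r t kl.1 *
      ((-1) ^ kl.2 / (kl.2.factorial : ℝ) * (lb ^ kl.2 * a kl.2)) = if n = 0 then 1 else 0 := by
    intro n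
    have h1 : (if n = 0 then (1 : ℝ) else 0) =
        (-lb) ^ n / (n.factorial : ℝ) * if n = 0 then 1 else 0 := by
      split_ifs with hn
      · simp [hn]
      · simp
    rw [h1, ← hrec n, Finset.mul_sum, Finset.Nat.sum_antidiagonal_eq_sum_range_succ_mk]
    refine Finset.sum_congr rfl fun k hk => ?_
    have hk' : k ≤ n := Nat.lt_succ_iff.1 (Finset.mem_range.1 hk)
    obtain ⟨m, rfl⟩ := Nat.exists_eq_add_of_le hk'
    rw [Nat.cast_add_choose, Nat.add_sub_cancel_left, JTerm, ← hlb, pow_add,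
      neg_pow lb m]
    have := (k + m).factorial_ne_zero
    have := k.factorial_ne_zero
    have := m.factorial_ne_zero
    simp only [ha]
    field_simp
  simp only [hcoef, tsum_ite_eq] at hprod
  rw [hA.tsum_eq, ← hJsum] at hprod
  -- `A = 0` is impossible, since the product with `JInhom` is 1.
  obtain rfl | hpos := hA0.eq_or_lt
  · simp at hprod
  · rw [eq_inv_of_mul_eq_one_left hprod]
    exact (one_le_inv₀ hpos).2 hA1

end IsIRMS

end STPP

/-! ### The main theorem -/

theorem mainTheorem4 (d : ℕ) (hd : 1 ≤ d) (β RS RT lam : ℝ)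
    (hβ : 0 < β) (hRS : 0 < RS) (hRT : 0 < RT)
    (P : Measure (STPP.Config d)) [IsProbabilityMeasure P]
    (hP : STPP.IsHardCore β RS RT P)
    (hlam : STPP.IsProductDensity P 1 (fun _ => lam))
    (K : Kernel (STPP.SpaceTime d) (STPP.Config d)) [IsMarkovKernel K]
    (hK : STPP.IsReducedPalm P (fun _ => lam) K)
    (hK0 : ∀ a, K a = (K 0).map (STPP.Config.translate a)) :
    1 ≤ β / lam ∧
    (∀ r t, 0 ≤ r → 0 ≤ t → STPP.hitProb P r t ≠ 1) ∧
    MonotoneOn (fun q : ℝ × ℝ => STPP.J P (K 0) q.1 q.2) (Set.Icc 0 RS ×ˢ Set.Icc 0 RT) ∧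
    MonotoneOn (fun q : ℝ × ℝ => STPP.J P (K 0) q.1 q.2) (Set.Ici RS ×ˢ Set.Ici RT) ∧
    (∀ r ∈ Set.Icc 0 RS, ∀ t ∈ Set.Icc 0 RT,
      1 ≤ STPP.J P (K 0) r t ∧ STPP.J P (K 0) r t ≤ β / lam) ∧
    (∀ r ∈ Set.Ici RS, ∀ t ∈ Set.Ici RT, STPP.J P (K 0) r t = β / lam) ∧
    (∀ R, RS = R → RT = R →
      MonotoneOn (fun r => STPP.J P (K 0) r r) (Set.Ici 0) ∧
      (∀ r ∈ Set.Ico 0 R, 1 ≤ STPP.J P (K 0) r r ∧ STPP.J P (K 0) r r < β / lam) ∧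
      (∀ r ∈ Set.Ici R, STPP.J P (K 0) r r = β / lam)) ∧
    (∀ p : STPP.SpaceTime d → unitInterval, Measurable p → (0 : ℝ) < ⨅ x, (p x : ℝ) →
      ∀ Pth : Measure (STPP.Config d), IsProbabilityMeasure Pth → STPP.IsThinning p P Pth →
      ∀ ρ : ∀ n : ℕ, (Fin n → STPP.SpaceTime d) → ℝ, STPP.IsIRMS Pth ρ →
      ∀ r ∈ Set.Icc 0 RS, ∀ t ∈ Set.Icc 0 RT, STPP.JInhomDefined ρ r t →
        1 ≤ STPP.JInhom ρ r t) := by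
  have heq : ∀ {r t : ℝ}, RS ≤ r → RT ≤ t → STPP.J P (K 0) r t = β / lam :=
    fun hr ht => hP.J_eq_div hβ hK hK0 hr ht
  have hmono : ∀ {r t r' t' : ℝ}, r ≤ r' → t ≤ t' → r' ≤ RS → t' ≤ RT →
      STPP.J P (K 0) r t ≤ STPP.J P (K 0) r' t' :=
    fun hr ht hr' ht' => hP.J_mono hβ hK hK0 hr ht hr' ht'
  have hone : ∀ {r t : ℝ}, r ≤ RS → t ≤ RT → 1 ≤ STPP.J P (K 0) r t :=
    fun hr ht => hP.one_le_J hβ hK hK0 hr ht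
  -- The corner `(RS, RT)` belongs to both regions: `J` increases up to it and equals `β / lam`
  -- there.
  have hle : ∀ {r t : ℝ}, r ≤ RS → t ≤ RT → STPP.J P (K 0) r t ≤ β / lam :=
    fun hr ht => (hmono hr ht le_rfl le_rfl).trans (heq le_rfl le_rfl).le
  refine ⟨(hone le_rfl le_rfl).trans (hle le_rfl le_rfl), fun r t _ _ => hP.hitProb_ne_one r t,
    ?_, ?_, fun r hr t ht => ⟨hone hr.2 ht.2, hle hr.2 ht.2⟩, fun r hr t ht => heq hr ht, ?_, ?_⟩
  · exact fun q _ q' hq' h => hmono h.1 h.2 hq'.1.2 hq'.2.2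
  · exact fun q hq q' hq' _ => ((heq hq.1 hq.2).trans (heq hq'.1 hq'.2).symm).le
  · rintro R rfl rfl
    refine ⟨fun r _ s _ hrs => ?_, fun r hr => ⟨hone hr.2.le hr.2.le, ?_⟩,
      fun r hr => heq hr hr⟩
    · rcases le_total s RT with hs | hs
      · exact hmono hrs hrs hs hs
      rcases le_total r RT with hr | hr
      · exact (hle hr hr).trans (heq hs hs).ge
      · exact ((heq hr hr).trans (heq hs hs).symm).le
    · rw [hP.J_eq_inv hβ hK hK0 hr.2.le hr.2.le, hP.div_intensity hβ hK hK0]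
      exact inv_strictAnti₀
        (hP.real_voidSet_pos (STPP.measurableSet_cyl d _ _) (STPP.isBounded_cyl d _ _))
        (hP.real_voidSet_cyl_lt hβ hRS hr.1 hr.2.le hr.2)
  · intro p _ _ Pth hPth hthin ρ hρ r hr t ht hJ
    exact hρ.one_le_JInhom hβ hP hthin hr.2 ht.2 hJ
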